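/- **Setting.** Work in propositional intuitionistic linear logic with connectives $\otimes, \&, \multimap, !$ over a set of atoms; proofs are sequent calculus proofs (axiom, cut, exchange, left and right rules for $\otimes,\&,\multimap$, promotion, dereliction, weakening, contraction), and "equivalent" means equivalent under cut-elimination. For a formula $A$ and $m\ge 1$ write $A^m = A\,\&\,\cdots\,\&\,A$ ($m$ copies) and ${}_m\mathbf{bool}_A = A^m\multimap A$. For $0\le i\le m-1$ let $\underline{i}$ be the proof of $\vdash {}_m\mathbf{bool}_A$ obtained from the axiom $A\vdash A$ by selecting the $i$-th factor of $A^m$ with left $\&$-rules and then applying the right $\multimap$-rule. A proof of $!A_1,\dots,!A_r\vdash B$ is *plain* if it is equivalent to one obtained from some proof of $n_1A_1,\dots,n_rA_r\vdash B$ (that is, with $n_i\ge 0$ copies of $A_i$ as hypotheses) by dereliction of all hypotheses followed by contractions and weakenings. A proof of $!A_1,\dots,!A_r\vdash\, !B_1\otimes\cdots\otimes !B_t$ is *component-wise plain* if there are plain proofs $\psi_i$ of $!A_1,\dots,!A_r\vdash B_i$ such that it is equivalent to $\bigotimes_i \mathrm{prom}(\psi_i)$ followed by contractions. A proof of $!A_1\otimes\cdots\otimes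 !A_r\vdash\, !B_1\otimes\cdots\otimes !B_t$ is called component-wise plain if it is equivalent to the left $\otimes$-rules applied to a component-wise plain proof of $!A_1,\dots,!A_r\vdash\, !B_1\otimes\cdots\otimes !B_t$. Let $s,n,h\ge 1$, $\Sigma=\{0,\dots,s-1\}$, $Q=\{0,\dots,n-1\}$, $H=\{0,\dots,h-1\}$, and let $\delta:\Sigma\times Q\to\Sigma\times Q\times\{\mathrm{left},\mathrm{right}\}$, $\delta(i,q)=(\hat\sigma_i^q,\hat q_i^q,\hat d_i^q)$. A configuration $C=(\sigma_0,\dots,\sigma_{h-1};q;p)$ consists of a tape $\sigma\in\Sigma^h$, a state $q\in Q$ and a head position $p\in H$; it is represented by the proof $$\underline{C}=\mathrm{prom}(\underline{\sigma_0})\otimes\cdots\otimes\mathrm{prom}(\underline{\sigma_{h-1}})\otimes\mathrm{prom}(\underline q)\otimes\mathrm{prom}(\underline p)$$ of $\vdash\, !{}_s\mathbf{bool}_A^{\otimes h}\otimes !{}_n\mathbf{bool}_A\otimes !{}_h\mathbf{bool}_A$. One step of the machine replaces $\sigma_p$ by $\hat\sigma_{\sigma_p}^q$, the state $q$ by $\hat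 q_{\sigma_p}^q$, and $p$ by $p-1$ if $\hat d_{\sigma_p}^q=\mathrm{left}$ and by $p+1$ if $\hat d_{\sigma_p}^q=\mathrm{right}$, modulo $h$. Write $\mathrm{step}(C)$ for the result. In the Sweedler semantics over a field $k$, a formula is interpreted as a vector space, $\otimes,\&,\multimap$ as tensor product, direct sum and space of linear maps, $!V$ as the cofree cocommutative coalgebra over $V$, and a proof $\pi$ as a linear map $[\![\pi]\!]$. For $P\in V$ the vacuum vector $|\varnothing\rangle_P\in\, !V$ is the unique group-like element lying over $P$. **Proposition.** For every formula $A$, all $s,n,h\ge1$ and every $\delta$ there is a proof $${}_h\underline{\mathrm{absstep}}:\ !{}_s\mathbf{bool}_A^{\otimes h}\otimes !{}_n\mathbf{bool}_A\otimes !{}_h\mathbf{bool}_A\ \vdash\ !{}_s\mathbf{bool}_A^{\otimes h}\otimes !{}_n\mathbf{bool}_A\otimes !{}_h\mathbf{bool}_A$$ such that: 1. ${}_h\underline{\mathrm{absstep}}$ is component-wise plain. 2. ${}_h\underline{\mathrm{absstep}}$ encodes one step of the machine: for every configuration $C$, the cut of $\underline{C}$ against ${}_h\underline{\mathrm{absstep}}$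 is equivalent under cut-elimination to $\underline{\mathrm{step}(C)}$. 3. For every algebraically closed field $k$, every interpretation of the atoms by $k$-vector spaces and all scalars $a^m_i, b_q, c_l\in k$ ($m,l\in H$, $i\in\Sigma$, $q\in Q$), with $$\alpha^m=\sum_{i\in\Sigma}a^m_i[\![\underline i]\!],\qquad \beta=\sum_{q\in Q}b_q[\![\underline q]\!],\qquad \gamma=\sum_{l\in H}c_l[\![\underline l]\!],$$ one has $$[\![{}_h\underline{\mathrm{absstep}}]\!]\big(|\varnothing\rangle_{\alpha^0}\otimes\cdots\otimes|\varnothing\rangle_{\alpha^{h-1}}\otimes|\varnothing\rangle_\beta\otimes|\varnothing\rangle_\gamma\big)=|\varnothing\rangle_{\theta^0}\otimes\cdots\otimes|\varnothing\rangle_{\theta^{h-1}}\otimes|\varnothing\rangle_\mu\otimes|\varnothing\rangle_\nu,$$ where $$\theta^m=\sum_{i\in\Sigma}\sum_{q\in Q}a^m_ib_q\Big(c_m[\![\underline{\hat\sigma_i^q}]\!]+\sum_{l\in H,\,l\ne m}c_l[\![\underline i]\!]\Big),$$ $$\mu=\sum_{i_0,\dots,i_{h-1}\in\Sigma}\ \sum_{q\in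 Q}\sum_{l\in H}a^0_{i_0}\cdots a^{h-1}_{i_{h-1}}b_qc_l[\![\underline{\hat q_{i_l}^q}]\!] =\sum_{l\in H}c_l\prod_{m\ne l}\Big(\sum_{i\in\Sigma}a^m_i\Big)\sum_{i\in\Sigma}\sum_{q\in Q}a^l_ib_q[\![\underline{\hat q_i^q}]\!],$$ $$\nu=\sum_{i_0,\dots,i_{h-1}\in\Sigma}\ \sum_{q\in Q}\sum_{p,l\in H}a^0_{i_0}\cdots a^{h-1}_{i_{h-1}}b_qc_pc_l[\![\underline{p\,\hat d_{i_l}^q}]\!] =\sum_{l\in H}c_l\prod_{m\ne l}\Big(\sum_{i\in\Sigma}a^m_i\Big)\sum_{i\in\Sigma}\sum_{q\in Q}\sum_{p\in H}a^l_ib_qc_p[\![\underline{p\,\hat d_i^q}]\!],$$ and $p\,\hat d$ denotes $p-1$ if $\hat d=\mathrm{left}$ and $p+1$ if $\hat d=\mathrm{right}$, computed modulo $h$. -/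

import Mathlib

set_option linter.unusedSectionVars false

namespace Sweedler

open scoped TensorProduct

open Coalgebra

universe u

section Local

variable {k : Type u} [Field k] {C : Type u} [AddCommGroup C] [Module k C] [Coalgebra k C]

/-- The operator `x ↦ ∑ β(x₍₂₎) x₍₁₎` attached to a functional `β`. -/
noncomputable def hit (β : C →ₗ[k] k) : C →ₗ[k] C :=
  (TensorProduct.rid k C).toLinearMap ∘ₗ β.lTensor C ∘ₗ comul

theorem hit_counit (x : C) : hit (k := k) counit x = x := by
  simp [hit]

theorem hit_hit (γ β : C →ₗ[k] k) (x : C) :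
    hit γ (hit β x) =
      hit (LinearMap.mul' k k ∘ₗ TensorProduct.map γ β ∘ₗ comul) x := by
  have key : ∀ u : C ⊗[k] C,
      hit γ ((TensorProduct.rid k C) (β.lTensor C u)) =
        (TensorProduct.rid k C) ((LinearMap.mul' k k ∘ₗ TensorProduct.map γ β).lTensor C
          (TensorProduct.assoc k C C C (comul.rTensor C u))) := by
    intro u
    induction u with
    | zero => simp
    | add u v hu hv => simp only [map_add, hu, hv]
    | tmul a b =>
      simp only [LinearMap.lTensor_tmul, TensorProduct.rid_tmul, map_smul, LinearMap.rTensor_tmul]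
      simp only [hit, LinearMap.comp_apply, LinearEquiv.coe_coe]
      generalize (comul a : C ⊗[k] C) = v
      induction v with
      | zero => simp
      | add u v hu hv => simp only [map_add, smul_add, TensorProduct.add_tmul, hu, hv]
      | tmul c d => simp [smul_smul, mul_comm]
  have h1 : hit β x = (TensorProduct.rid k C) (β.lTensor C (comul x)) := rfl
  rw [h1, key, Coalgebra.coassoc_apply, ← LinearMap.comp_apply (LinearMap.lTensor C _),
    ← LinearMap.lTensor_comp]
  rfl

/-- If all slices of a tensor lie in the range of an idempotent `P`, then `P ⊗ 1` fixes it. -/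
theorem rTensor_eq_self_of_slices (P : C →ₗ[k] C) (t : C ⊗[k] C)
    (h : ∀ γ : C →ₗ[k] k, P (TensorProduct.rid k C (γ.lTensor C t)) =
      TensorProduct.rid k C (γ.lTensor C t)) :
    P.rTensor C t = t := by
  classical
  let b := Module.Basis.ofVectorSpace k C
  apply (TensorProduct.equivFinsuppOfBasisRight (M := C) b).injective
  ext i
  have aux : ∀ s : C ⊗[k] C, TensorProduct.equivFinsuppOfBasisRight (M := C) b s i =
      TensorProduct.rid k C ((b.coord i).lTensor C s) := by
    intro s
    induction s with
    | zero => simp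
    | add u v hu hv => simp only [map_add, Finsupp.add_apply, hu, hv]
    | tmul c d => simp
  rw [aux, aux, ← h (b.coord i)]
  generalize t = s
  induction s with
  | zero => simp
  | add u v hu hv => simp only [map_add, hu, hv]
  | tmul c d => simp

end Local

/-- A copy of `k ^ n` that carries no coalgebra structure of its own. -/
def Coord (k : Type u) (n : ℕ) : Type u := Fin n → k

noncomputable instance (k : Type u) [Field k] (n : ℕ) : AddCommGroup (Coord k n) :=
  inferInstanceAs (AddCommGroup (Fin n → k))

noncomputable instance (k : Type u) [Field k] (n : ℕ) : Module k (Coord k n) :=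
  inferInstanceAs (Module k (Fin n → k))

instance (k : Type u) [Field k] (n : ℕ) : FiniteDimensional k (Coord k n) :=
  inferInstanceAs (FiniteDimensional k (Fin n → k))

/-- Finite-dimensional cocommutative coalgebras, up to isomorphism. -/
structure FinCoalg (k : Type u) [Field k] : Type u where
  dim : ℕ
  coalg : Coalgebra k (Coord k dim)
  cocomm : IsCocomm k (Coord k dim)

/-- The underlying space. -/
abbrev FinCoalg.Carrier {k : Type u} [Field k] (D : FinCoalg k) : Type u := Coord k D.dim

noncomputable instance {k : Type u} [Field k] (D : FinCoalg k) : Coalgebra k D.Carrier := D.coalg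

instance {k : Type u} [Field k] (D : FinCoalg k) : IsCocomm k D.Carrier := D.cocomm

section Cover

variable {k : Type u} [Field k] {C : Type u} [AddCommGroup C] [Module k C] [Coalgebra k C]
  [IsCocomm k C]

/-- The coalgebra structure on a linear retract of `C` whose image is closed under `Δ`. -/
noncomputable abbrev retractCoalgebra {K : Type u} [AddCommGroup K] [Module k K]
    (i : K →ₗ[k] C) (p : C →ₗ[k] K) (hpi : p ∘ₗ i = LinearMap.id)
    (h : TensorProduct.map i i ∘ₗ TensorProduct.map p p ∘ₗ comul ∘ₗ i = comul ∘ₗ i) :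
    Coalgebra k K where
  comul := TensorProduct.map p p ∘ₗ comul ∘ₗ i
  counit := counit ∘ₗ i
  coassoc := by
    have inj : Function.Injective
        (TensorProduct.map i (TensorProduct.map i i) : K ⊗[k] (K ⊗[k] K) →ₗ[k] _) := by
      apply Function.LeftInverse.injective
        (g := (TensorProduct.map p (TensorProduct.map p p) : C ⊗[k] (C ⊗[k] C) →ₗ[k] _))
      intro x
      rw [← LinearMap.comp_apply, ← TensorProduct.map_comp, ← TensorProduct.map_comp, hpi]
      simp
    ext1 x
    apply inj
    have h' : ∀ y, TensorProduct.map i i (TensorProduct.map p p (comul (i y))) = comul (i y) :=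
      fun y => congrArg (fun f => f y) h
    have e1 : ∀ t : K ⊗[k] K, TensorProduct.map i (TensorProduct.map i i)
        (TensorProduct.assoc k K K K ((TensorProduct.map p p ∘ₗ comul ∘ₗ i).rTensor K t)) =
        TensorProduct.assoc k C C C (comul.rTensor C (TensorProduct.map i i t)) := by
      intro t
      induction t with
      | zero => simp
      | add u v hu hv => simp only [map_add, hu, hv]
      | tmul a b =>
        simp only [LinearMap.rTensor_tmul, TensorProduct.map_tmul, LinearMap.comp_apply]
        rw [← h' a]
        have hpi' : ∀ y, p (i y) = y := fun y => congrArg (fun f => f y) hpi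
        generalize TensorProduct.map p p (comul (i a)) = s
        induction s with
        | zero => simp
        | add u v hu hv => simp only [map_add, TensorProduct.add_tmul, hu, hv]
        | tmul c d => simp [hpi']
    have e2 : ∀ t : K ⊗[k] K, TensorProduct.map i (TensorProduct.map i i)
        ((TensorProduct.map p p ∘ₗ comul ∘ₗ i).lTensor K t) =
        comul.lTensor C (TensorProduct.map i i t) := by
      intro t
      induction t with
      | zero => simp
      | add u v hu hv => simp only [map_add, hu, hv]
      | tmul a b => simp [h']
    simp only [LinearMap.comp_apply, LinearEquiv.coe_coe]
    rw [e1, e2, h', Coalgebra.coassoc_apply]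
  rTensor_counit_comp_comul := by
    ext1 x
    have h' : TensorProduct.map i i (TensorProduct.map p p (comul (i x))) = comul (i x) :=
      congrArg (fun f => f x) h
    have e1 : ∀ t : K ⊗[k] K, (counit ∘ₗ i).rTensor K t =
        p.lTensor k ((counit (R := k) (A := C)).rTensor C (TensorProduct.map i i t)) := by
      intro t
      induction t with
      | zero => simp
      | add u v hu hv => simp only [map_add, hu, hv]
      | tmul a b =>
        have := congrArg (fun f => f b) hpi
        simp only [LinearMap.comp_apply, LinearMap.id_apply] at this
        simp [this]
    have := congrArg (fun f => f x) hpi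
    simp only [LinearMap.comp_apply, LinearMap.id_apply] at this
    simp only [LinearMap.comp_apply]
    rw [e1, h', Coalgebra.rTensor_counit_comul]
    simp [this]
  lTensor_counit_comp_comul := by
    ext1 x
    have h' : TensorProduct.map i i (TensorProduct.map p p (comul (i x))) = comul (i x) :=
      congrArg (fun f => f x) h
    have e1 : ∀ t : K ⊗[k] K, (counit ∘ₗ i).lTensor K t =
        p.rTensor k ((counit (R := k) (A := C)).lTensor C (TensorProduct.map i i t)) := by
      intro t
      induction t with
      | zero => simp
      | add u v hu hv => simp only [map_add, hu, hv]
      | tmul a b =>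
        have := congrArg (fun f => f a) hpi
        simp only [LinearMap.comp_apply, LinearMap.id_apply] at this
        simp [this]
    have := congrArg (fun f => f x) hpi
    simp only [LinearMap.comp_apply, LinearMap.id_apply] at this
    simp only [LinearMap.comp_apply]
    rw [e1, h', Coalgebra.lTensor_counit_comul]
    simp [this]

/-- A finite-dimensional subspace that is stable under all `hit β` is a subcoalgebra. -/
theorem exists_finCoalg_of_stable (D : Submodule k C) [FiniteDimensional k D]
    (hD : ∀ (β : C →ₗ[k] k), ∀ x ∈ D, hit β x ∈ D) :
    ∃ (E : FinCoalg k) (j : E.Carrier →ₗc[k] C),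
      Function.Injective j ∧ LinearMap.range (j : E.Carrier →ₗ[k] C) = D := by
  let n := Module.finrank k D
  let e : Coord k n ≃ₗ[k] D := (Module.finBasis k D).equivFun.symm
  obtain ⟨q, hq⟩ := D.subtype.exists_leftInverse_of_injective (by simp)
  let i : Coord k n →ₗ[k] C := D.subtype ∘ₗ e.toLinearMap
  let p : C →ₗ[k] Coord k n := e.symm.toLinearMap ∘ₗ q
  have hpi : p ∘ₗ i = LinearMap.id := by
    ext1 x
    have : q (D.subtype (e x)) = e x := congrArg (fun f => f (e x)) hq
    change e.symm (q (D.subtype (e x))) = x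
    rw [this, LinearEquiv.symm_apply_apply]
  have hP : ∀ x ∈ D, (i ∘ₗ p) x = x := by
    intro x hx
    have : q x = ⟨x, hx⟩ := congrArg (fun f => f ⟨x, hx⟩) hq
    simp [p, i, this]
  have hfix : ∀ x ∈ D, TensorProduct.map i i (TensorProduct.map p p (comul x)) =
      (comul x : C ⊗[k] C) := by
    intro x hx
    have h1 : (i ∘ₗ p).rTensor C (comul x) = (comul x : C ⊗[k] C) := by
      apply rTensor_eq_self_of_slices
      intro γ
      exact hP _ (hD γ x hx)
    have h2 : (i ∘ₗ p).lTensor C (comul x) = (comul x : C ⊗[k] C) := by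
      have h3 := congrArg (TensorProduct.comm k C C) h1
      rw [comm_comul] at h3
      conv_rhs => rw [← h3]
      conv_lhs => rw [← comm_comul k x]
      generalize (comul x : C ⊗[k] C) = s
      induction s with
      | zero => simp
      | add u v hu hv => simp only [map_add, hu, hv]
      | tmul c d => simp
    conv_rhs => rw [← h1, ← h2]
    generalize (comul x : C ⊗[k] C) = s
    induction s with
    | zero => simp
    | add u v hu hv => simp only [map_add, hu, hv]
    | tmul c d => simp
  have hi : TensorProduct.map i i ∘ₗ TensorProduct.map p p ∘ₗ comul ∘ₗ i = comul ∘ₗ i := by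
    ext1 x
    exact hfix _ (e x).2
  let inst : Coalgebra k (Coord k n) := retractCoalgebra i p hpi hi
  have hc : IsCocomm k (Coord k n) := by
    constructor
    ext1 x
    change TensorProduct.comm k _ _ (TensorProduct.map p p (comul (i x))) =
      TensorProduct.map p p (comul (i x))
    conv_rhs => rw [← comm_comul k (i x)]
    generalize (comul (i x) : C ⊗[k] C) = s
    induction s with
    | zero => simp
    | add u v hu hv => simp only [map_add, hu, hv]
    | tmul c d => simp
  refine ⟨⟨n, inst, hc⟩, ⟨i, rfl, hi⟩, ?_, ?_⟩
  · exact Subtype.val_injective.comp e.injective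
  · change LinearMap.range (D.subtype ∘ₗ e.toLinearMap) = D
    rw [LinearMap.range_comp, LinearEquiv.range, Submodule.map_top, Submodule.range_subtype]

/-- The subspace `{hit β x}`, the smallest subcoalgebra containing `x`. -/
noncomputable def orbit (x : C) : Submodule k C :=
  LinearMap.range ((TensorProduct.rid k C).toLinearMap ∘ₗ
    LinearMap.applyₗ (comul x : C ⊗[k] C) ∘ₗ LinearMap.lTensorHom (R := k) C (N := C) (P := k))

theorem mem_orbit {x y : C} : y ∈ orbit (k := k) x ↔ ∃ β : C →ₗ[k] k, hit β x = y := Iff.rfl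

theorem orbit_finite (x : C) : FiniteDimensional k (orbit (k := k) x) := by
  classical
  obtain ⟨S, hS⟩ := TensorProduct.exists_finset (R := k) (comul x : C ⊗[k] C)
  have : orbit (k := k) x ≤ Submodule.span k ((S.image Prod.fst : Finset C) : Set C) := by
    rintro y ⟨β, rfl⟩
    change (TensorProduct.rid k C) (β.lTensor C (comul x)) ∈ _
    rw [hS]
    simp only [map_sum, LinearMap.lTensor_tmul, TensorProduct.rid_tmul]
    refine Submodule.sum_mem _ fun i hi => Submodule.smul_mem _ _ (Submodule.subset_span ?_)
    simpa using ⟨i.2, hi⟩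
  exact Submodule.finiteDimensional_of_le this

/-- Every finite-dimensional subspace of a cocommutative coalgebra lies in a finite-dimensional
subcoalgebra. -/
theorem exists_cover (W : Submodule k C) (hW : W.FG) :
    ∃ (E : FinCoalg k) (j : E.Carrier →ₗc[k] C),
      Function.Injective j ∧ W ≤ LinearMap.range (j : E.Carrier →ₗ[k] C) := by
  obtain ⟨S, rfl⟩ := hW
  let D : Submodule k C := ⨆ x : S, orbit (k := k) (x : C)
  have : ∀ x : S, FiniteDimensional k (orbit (k := k) (x : C)) := fun x => orbit_finite _
  have : FiniteDimensional k D := Submodule.finiteDimensional_iSup _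
  have hD : ∀ (β : C →ₗ[k] k), ∀ x ∈ D, hit β x ∈ D := by
    intro β
    suffices D ≤ D.comap (hit β) from this
    refine iSup_le fun s => ?_
    rintro y ⟨γ, rfl⟩
    refine (le_iSup (fun x : S => orbit (k := k) (x : C)) s) ?_
    exact mem_orbit.2 ⟨_, (hit_hit β γ (s : C)).symm⟩
  obtain ⟨E, j, hj, hr⟩ := exists_finCoalg_of_stable D hD
  refine ⟨E, j, hj, ?_⟩
  rw [hr, Submodule.span_le]
  intro x hx
  exact (le_iSup (fun x : S => orbit (k := k) (x : C)) ⟨x, hx⟩) (mem_orbit.2 ⟨_, hit_counit x⟩)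

/-- A map that becomes a coalgebra morphism after an injective coalgebra morphism is one. -/
theorem exists_factor {A B : Type u} [AddCommGroup A] [Module k A] [Coalgebra k A]
    [AddCommGroup B] [Module k B] [Coalgebra k B] (g : A →ₗc[k] C) (j : B →ₗc[k] C)
    (hj : Function.Injective j)
    (hr : LinearMap.range (g : A →ₗ[k] C) ≤ LinearMap.range (j : B →ₗ[k] C)) :
    ∃ f : A →ₗc[k] B, j.comp f = g := by
  obtain ⟨p, hp⟩ := (j : B →ₗ[k] C).exists_leftInverse_of_injective
    (LinearMap.ker_eq_bot.2 hj)
  have hp' : ∀ y, p (j y) = y := fun y => congrArg (fun f => f y) hp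
  have hf : ∀ x, j (p (g x)) = g x := by
    intro x
    obtain ⟨y, hy⟩ := hr ⟨x, rfl⟩
    have hy' : j y = g x := hy
    rw [← hy', hp']
  have inj : Function.Injective
      (TensorProduct.map (j : B →ₗ[k] C) (j : B →ₗ[k] C)) := by
    apply Function.LeftInverse.injective (g := TensorProduct.map p p)
    intro x
    rw [← LinearMap.comp_apply, ← TensorProduct.map_comp, hp]
    simp
  have hfl : (j : B →ₗ[k] C) ∘ₗ (p ∘ₗ (g : A →ₗ[k] C)) = (g : A →ₗ[k] C) := by
    ext1 x
    exact hf x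
  refine ⟨⟨p ∘ₗ (g : A →ₗ[k] C), ?_, ?_⟩, ?_⟩
  · ext1 x
    change counit (p (g x)) = counit x
    rw [← CoalgHomClass.counit_comp_apply j, hf, CoalgHomClass.counit_comp_apply]
  · ext1 x
    apply inj
    rw [← LinearMap.comp_apply, ← LinearMap.comp_apply, ← LinearMap.comp_assoc,
      ← TensorProduct.map_comp, hfl]
    change TensorProduct.map (g : A →ₗ[k] C) (g : A →ₗ[k] C) (comul x) =
      TensorProduct.map (j : B →ₗ[k] C) (j : B →ₗ[k] C) (comul (p (g x)))
    rw [CoalgHomClass.map_comp_comul_apply g, CoalgHomClass.map_comp_comul_apply j, hf]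
  · ext x
    exact hf x

end Cover

section Cofree

variable (k : Type u) [Field k] (V : Type u) [AddCommGroup V] [Module k V]

/-- A finite-dimensional cocommutative coalgebra with a linear map to `V`. -/
structure FinCoalgOver : Type u where
  src : FinCoalg k
  map : src.Carrier →ₗ[k] V

noncomputable instance : DecidableEq (FinCoalgOver k V) := Classical.decEq _

/-- The direct sum of all finite-dimensional cocommutative coalgebras over `V`. -/
abbrev CoalgSum : Type u := Π₀ i : FinCoalgOver k V, i.src.Carrier

variable {k V} in
/-- The inclusion of a summand, as a coalgebra morphism. -/
noncomputable def summand (i : FinCoalgOver k V) : i.src.Carrier →ₗc[k] CoalgSum k V :=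
  { (DFinsupp.lsingle (M := fun i : FinCoalgOver k V => i.src.Carrier) i :
      i.src.Carrier →ₗ[k] CoalgSum k V) with
    counit_comp := DFinsupp.counit_comp_lsingle k _ (fun i : FinCoalgOver k V => i.src.Carrier) i
    map_comp_comul :=
      (DFinsupp.comul_comp_lsingle k _ (fun i : FinCoalgOver k V => i.src.Carrier) i).symm }

/-- The relations `x ∼ f x`, for `f` a coalgebra morphism over `V`. -/
noncomputable def relations : Submodule k (CoalgSum k V) :=
  Submodule.span k {z | ∃ (i j : FinCoalgOver k V) (f : i.src.Carrier →ₗc[k] j.src.Carrier),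
    j.map ∘ₗ (f : i.src.Carrier →ₗ[k] j.src.Carrier) = i.map ∧
      ∃ x, z = summand i x - summand j (f x)}

instance : (relations k V).IsCoideal where
  counit_eq_zero := by
    intro x hx
    have : relations k V ≤ LinearMap.ker (counit (R := k) (A := CoalgSum k V)) := by
      refine Submodule.span_le.2 ?_
      rintro _ ⟨i, j, f, -, x, rfl⟩
      simp [CoalgHomClass.counit_comp_apply]
    exact this hx
  map_mkQ_comul_eq_zero := by
    intro x hx
    have : relations k V ≤ LinearMap.ker
        (TensorProduct.map (relations k V).mkQ (relations k V).mkQ ∘ₗ comul (R := k)) := by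
      refine Submodule.span_le.2 ?_
      rintro _ ⟨i, j, f, hf, x, rfl⟩
      have h : (relations k V).mkQ ∘ₗ (summand i : i.src.Carrier →ₗ[k] CoalgSum k V) =
          (relations k V).mkQ ∘ₗ (summand j : j.src.Carrier →ₗ[k] CoalgSum k V) ∘ₗ
            (f : i.src.Carrier →ₗ[k] j.src.Carrier) := by
        ext1 y
        exact (Submodule.Quotient.eq _).2 (Submodule.subset_span ⟨i, j, f, hf, y, rfl⟩)
      have e1 := CoalgHomClass.map_comp_comul_apply (summand i) x
      have e2 := CoalgHomClass.map_comp_comul_apply (summand j) (f x)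
      have e3 := CoalgHomClass.map_comp_comul_apply f x
      rw [SetLike.mem_coe, LinearMap.mem_ker, LinearMap.comp_apply, map_sub, map_sub, sub_eq_zero,
        ← e1, ← e2, ← e3]
      simp only [← LinearMap.comp_apply, ← LinearMap.comp_assoc, ← TensorProduct.map_comp]
      rw [LinearMap.comp_apply, LinearMap.comp_apply, h, LinearMap.comp_assoc]
    exact this hx

/-- The universal cocommutative coassociative counital coalgebra `!V` mapping to `V`: the colimit
of all finite-dimensional cocommutative coalgebras over `V`. Its universal property is
`Bang.existsUnique_lift`. -/
def Bang : Type u := CoalgSum k V ⧸ relations k V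

namespace Bang

noncomputable instance : AddCommGroup (Bang k V) :=
  inferInstanceAs (AddCommGroup (CoalgSum k V ⧸ relations k V))

noncomputable instance : Module k (Bang k V) :=
  inferInstanceAs (Module k (CoalgSum k V ⧸ relations k V))

noncomputable instance : Coalgebra k (Bang k V) :=
  inferInstanceAs (Coalgebra k (CoalgSum k V ⧸ relations k V))

/-- The quotient map. -/
noncomputable def proj : CoalgSum k V →ₗc[k] Bang k V :=
  Coalgebra.Quotient.mkQCoalgHom (relations k V)

theorem proj_surjective : Function.Surjective (proj k V) := Submodule.Quotient.mk_surjective _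

instance : IsCocomm k (Bang k V) where
  comm_comp_comul := by
    ext1 x
    obtain ⟨x, rfl⟩ := proj_surjective k V x
    rw [LinearMap.comp_apply, ← CoalgHomClass.map_comp_comul_apply]
    conv_rhs => rw [← comm_comul k x]
    generalize (comul x : CoalgSum k V ⊗[k] CoalgSum k V) = s
    induction s with
    | zero => simp
    | add u v hu hv => simp only [map_add, hu, hv]
    | tmul c d => simp

variable {k V}

/-- The coprojection of a finite-dimensional coalgebra over `V`. -/
noncomputable def incl (i : FinCoalgOver k V) : i.src.Carrier →ₗc[k] Bang k V :=
  (proj k V).comp (summand i)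

theorem incl_comp (i j : FinCoalgOver k V) (f : i.src.Carrier →ₗc[k] j.src.Carrier)
    (hf : j.map ∘ₗ (f : i.src.Carrier →ₗ[k] j.src.Carrier) = i.map) (x : i.src.Carrier) :
    incl j (f x) = incl i x :=
  ((Submodule.Quotient.eq (relations k V)).2
    (Submodule.subset_span ⟨i, j, f, hf, x, rfl⟩)).symm

theorem hom_ext {M : Type*} [AddCommGroup M] [Module k M] {F G : Bang k V →ₗ[k] M}
    (h : ∀ i x, F (incl i x) = G (incl i x)) : F = G := by
  classical
  have : F ∘ₗ (proj k V : CoalgSum k V →ₗ[k] Bang k V) =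
      G ∘ₗ (proj k V : CoalgSum k V →ₗ[k] Bang k V) := by
    refine DFinsupp.lhom_ext fun i x => h i x
  ext1 x
  obtain ⟨y, rfl⟩ := proj_surjective k V x
  exact congrArg (fun f => f y) this

variable (k V) in
/-- The universal map `d : !V → V`. -/
noncomputable def der : Bang k V →ₗ[k] V :=
  (relations k V).liftQ (DFinsupp.lsum (M := fun i : FinCoalgOver k V => i.src.Carrier) k fun i => i.map) (by
    refine Submodule.span_le.2 ?_
    rintro _ ⟨i, j, f, hf, x, rfl⟩
    rw [SetLike.mem_coe, LinearMap.mem_ker, map_sub, sub_eq_zero]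
    change DFinsupp.lsum (M := fun i : FinCoalgOver k V => i.src.Carrier) k _
      (DFinsupp.single i x) = DFinsupp.lsum (M := fun i : FinCoalgOver k V => i.src.Carrier) k _
      (DFinsupp.single j (f x))
    rw [DFinsupp.lsum_single, DFinsupp.lsum_single, ← hf]
    rfl)

theorem der_incl (i : FinCoalgOver k V) (x : i.src.Carrier) : der k V (incl i x) = i.map x := by
  classical
  change DFinsupp.lsum (M := fun i : FinCoalgOver k V => i.src.Carrier) k _
    (DFinsupp.single i x) = _
  rw [DFinsupp.lsum_single]

section Lift

variable {C : Type u} [AddCommGroup C] [Module k C] [Coalgebra k C] [IsCocomm k C]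

theorem incl_eq_of_eq (f : C →ₗ[k] V) {D E : FinCoalg k} (g : D.Carrier →ₗc[k] C)
    (h : E.Carrier →ₗc[k] C) (hh : Function.Injective h) {x : D.Carrier} {y : E.Carrier}
    (hxy : g x = h y) :
    incl ⟨D, f ∘ₗ (g : D.Carrier →ₗ[k] C)⟩ x = incl ⟨E, f ∘ₗ (h : E.Carrier →ₗ[k] C)⟩ y := by
  obtain ⟨K, j, hj, hr⟩ := exists_cover
    (LinearMap.range (g : D.Carrier →ₗ[k] C) ⊔ LinearMap.range (h : E.Carrier →ₗ[k] C))
    (Submodule.FG.sup (Module.Finite.iff_fg.1 inferInstance) (Module.Finite.iff_fg.1 inferInstance))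
  obtain ⟨g', rfl⟩ := exists_factor g j hj (le_sup_left.trans hr)
  obtain ⟨h', rfl⟩ := exists_factor h j hj (le_sup_right.trans hr)
  rw [← incl_comp ⟨D, _⟩ ⟨K, f ∘ₗ (j : K.Carrier →ₗ[k] C)⟩ g' rfl x,
    ← incl_comp ⟨E, _⟩ ⟨K, f ∘ₗ (j : K.Carrier →ₗ[k] C)⟩ h' rfl y]
  exact congrArg _ (hj hxy)

theorem exists_lift (f : C →ₗ[k] V) : ∃ F : C →ₗc[k] Bang k V,
    ∀ (D : FinCoalg k) (g : D.Carrier →ₗc[k] C) (x : D.Carrier),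
      F (g x) = incl ⟨D, f ∘ₗ (g : D.Carrier →ₗ[k] C)⟩ x := by
  have hc : ∀ x : C, ∃ (E : FinCoalg k) (j : E.Carrier →ₗc[k] C) (y : E.Carrier),
      Function.Injective j ∧ j y = x := by
    intro x
    obtain ⟨E, j, hj, hr⟩ := exists_cover (k := k) (Submodule.span k {x})
      (Submodule.fg_span_singleton x)
    obtain ⟨y, hy⟩ := hr (Submodule.mem_span_singleton_self x)
    exact ⟨E, j, y, hj, hy⟩
  choose E j y hj hy using hc
  let F : C → Bang k V := fun x => incl ⟨E x, f ∘ₗ (j x : (E x).Carrier →ₗ[k] C)⟩ (y x)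
  have hF : ∀ (D : FinCoalg k) (g : D.Carrier →ₗc[k] C) (x : D.Carrier),
      F (g x) = incl ⟨D, f ∘ₗ (g : D.Carrier →ₗ[k] C)⟩ x := by
    intro D g x
    exact (incl_eq_of_eq f g (j (g x)) (hj _) (hy _).symm).symm
  let L : C →ₗ[k] Bang k V :=
    { toFun := F
      map_add' := by
        intro a b
        obtain ⟨K, i, hi, hr⟩ := exists_cover (k := k) (Submodule.span k {a, b})
          (Submodule.fg_span (Set.toFinite _))
        obtain ⟨a, rfl⟩ := hr (Submodule.subset_span (by simp : a ∈ ({a, b} : Set C)))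
        obtain ⟨b, rfl⟩ := hr (Submodule.subset_span (by simp : b ∈ ({_, b} : Set C)))
        change F (i a + i b) = F (i a) + F (i b)
        rw [← map_add, hF, hF, hF, map_add]
      map_smul' := by
        intro c a
        obtain ⟨K, i, hi, hr⟩ := exists_cover (k := k) (Submodule.span k {a})
          (Submodule.fg_span_singleton a)
        obtain ⟨a, rfl⟩ := hr (Submodule.mem_span_singleton_self a)
        change F (c • i a) = c • F (i a)
        rw [← map_smul, hF, hF, map_smul] }
  have hL : ∀ (x : C), L ∘ₗ (j x : (E x).Carrier →ₗ[k] C) =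
      (incl ⟨E x, f ∘ₗ (j x : (E x).Carrier →ₗ[k] C)⟩ : _ →ₗ[k] Bang k V) := by
    intro x
    ext1 z
    exact hF _ _ _
  refine ⟨⟨L, ?_, ?_⟩, hF⟩
  · ext1 x
    change counit (F x) = counit x
    rw [CoalgHomClass.counit_comp_apply]
    conv_rhs => rw [← hy x]
    rw [CoalgHomClass.counit_comp_apply]
  · ext1 x
    change TensorProduct.map L L (comul x) = comul (F x)
    rw [← CoalgHomClass.map_comp_comul_apply]
    conv_lhs => rw [← hy x]
    rw [← CoalgHomClass.map_comp_comul_apply, ← LinearMap.comp_apply, ← TensorProduct.map_comp, hL]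

/-- The universal property of `!V`. -/
theorem existsUnique_lift (f : C →ₗ[k] V) :
    ∃! F : C →ₗc[k] Bang k V, der k V ∘ₗ (F : C →ₗ[k] Bang k V) = f := by
  obtain ⟨F, hF⟩ := exists_lift f
  have hcov : ∀ x : C, ∃ (E : FinCoalg k) (j : E.Carrier →ₗc[k] C) (y : E.Carrier), j y = x := by
    intro x
    obtain ⟨E, j, hj, hr⟩ := exists_cover (k := k) (Submodule.span k {x})
      (Submodule.fg_span_singleton x)
    obtain ⟨y, hy⟩ := hr (Submodule.mem_span_singleton_self x)
    exact ⟨E, j, y, hy⟩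
  refine ⟨F, ?_, ?_⟩
  · ext1 x
    obtain ⟨E, j, y, rfl⟩ := hcov x
    change der k V (F (j y)) = _
    rw [hF, der_incl]
    rfl
  · intro H hH
    obtain ⟨I, hI⟩ := exists_lift (der k V)
    have hid : (I : Bang k V →ₗ[k] Bang k V) = LinearMap.id := by
      refine hom_ext fun i x => ?_
      change I (incl i x) = incl i x
      rw [hI]
      have := incl_comp ⟨i.src, der k V ∘ₗ (incl i : i.src.Carrier →ₗ[k] Bang k V)⟩ i
        (CoalgHom.id k i.src.Carrier) (by ext1 z; exact (der_incl i z).symm) x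
      exact this.symm
    ext x
    obtain ⟨E, j, y, rfl⟩ := hcov x
    have h1 := hI E (H.comp j) y
    have h2 : I ((H.comp j) y) = H (j y) := congrArg (fun f => f (H (j y))) hid
    rw [hF, ← h2, h1]
    congr 2
    subst hH
    rfl

/-- The coalgebra morphism `C → !V` lifting a linear map `C → V`. -/
noncomputable def lift (f : C →ₗ[k] V) : C →ₗc[k] Bang k V := (existsUnique_lift f).choose

theorem der_comp_lift (f : C →ₗ[k] V) : der k V ∘ₗ (lift f : C →ₗ[k] Bang k V) = f :=
  (existsUnique_lift f).choose_spec.1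

end Lift

/-- The vacuum vector `|∅⟩_P`: the unique group-like element of `!V` lying over `P`. -/
noncomputable def vac (P : V) : Bang k V := lift (LinearMap.toSpanSingleton k V P) (1 : k)

theorem vac_isGroupLike (P : V) : IsGroupLikeElem k (vac P : Bang k V) :=
  IsGroupLikeElem.map (lift (LinearMap.toSpanSingleton k V P)) (isGroupLikeElem_self.2 rfl)

theorem der_vac (P : V) : der k V (vac P) = P := by
  have := congrArg (fun f => f (1 : k)) (der_comp_lift (LinearMap.toSpanSingleton k V P))
  exact this.trans (one_smul k P)

end Bang

end Cofree

end Sweedler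

namespace ILL

universe u v w

/-! ### Formulas and contexts -/

/-- Formulas of propositional intuitionistic linear logic with connectives `⊗`, `&`, `⊸`, `!`. -/
inductive Formula (α : Type v) : Type v
  | atom (x : α) : Formula α
  | tensor (A B : Formula α) : Formula α
  | wth (A B : Formula α) : Formula α
  | lolli (A B : Formula α) : Formula α
  | bang (A : Formula α) : Formula α

/-- `!Γ`. -/
abbrev bangs {α : Type v} (Γ : List (Formula α)) : List (Formula α) := Γ.map Formula.bang

/-- `!A₁ ⊗ (!A₂ ⊗ ⋯ ⊗ (!Aᵣ ⊗ !B))` for `L = [A₁, …, Aᵣ]`. -/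
def bangTensor {α : Type v} : List (Formula α) → Formula α → Formula α
  | [], B => .bang B
  | A :: L, B => .tensor (.bang A) (bangTensor L B)

/-- `Aⁿ = A & (A & ⋯ )` with `n` copies of `A`, for `n ≥ 1` (the value at `n = 0` is junk). -/
def power {α : Type v} (A : Formula α) : ℕ → Formula α
  | 0 => A
  | 1 => A
  | n + 2 => .wth A (power A (n + 1))

/-- The type of `n`-booleans `Aⁿ ⊸ A`. -/
def nbool {α : Type v} (A : Formula α) (n : ℕ) : Formula α := .lolli (power A n) A

/-- A family of elements indexed by the entries of a list. -/
def Tuple {β : Type v} (f : β → Type w) : List β → Type w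
  | [] => PUnit
  | a :: l => f a × Tuple f l

/-! ### Exchanges -/

/-- Sequences of exchanges, that is, permutations of a list as data. -/
inductive Exch {β : Type v} : List β → List β → Type v
  | nil : Exch [] []
  | cons (a : β) {Γ Δ : List β} (σ : Exch Γ Δ) : Exch (a :: Γ) (a :: Δ)
  | swap (a b : β) (Γ : List β) : Exch (a :: b :: Γ) (b :: a :: Γ)
  | trans {Γ Δ Θ : List β} (σ : Exch Γ Δ) (τ : Exch Δ Θ) : Exch Γ Θ

namespace Exch

variable {β : Type v}

/-- The action of an exchange on a list of labels for the positions. -/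
def act {γ : Type w} : {Γ Δ : List β} → Exch Γ Δ → List γ → List γ
  | _, _, nil, l => l
  | _, _, cons _ _, [] => []
  | _, _, cons _ σ, x :: l => x :: σ.act l
  | _, _, swap _ _ _, x :: y :: l => y :: x :: l
  | _, _, swap _ _ _, l => l
  | _, _, trans σ τ, l => τ.act (σ.act l)

/-- Two sequences of exchanges that induce the same permutation of positions. -/
def Same {Γ Δ : List β} (σ τ : Exch Γ Δ) : Prop :=
  σ.act (List.range Γ.length) = τ.act (List.range Γ.length)

/-- The identity. -/
def refl : (Γ : List β) → Exch Γ Γ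
  | [] => nil
  | a :: Γ => cons a (refl Γ)

/-- The identity, along an equality of lists. -/
def ofEq {Γ Δ : List β} (h : Γ = Δ) : Exch Γ Δ := h ▸ refl Γ

/-- The inverse. -/
def symm : {Γ Δ : List β} → Exch Γ Δ → Exch Δ Γ
  | _, _, nil => nil
  | _, _, cons a σ => cons a σ.symm
  | _, _, swap a b Γ => swap b a Γ
  | _, _, trans σ τ => trans τ.symm σ.symm

/-- `Γ, Δ ⟶ Γ, Δ'`. -/
def under : (Γ : List β) → {Δ Δ' : List β} → Exch Δ Δ' → Exch (Γ ++ Δ) (Γ ++ Δ')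
  | [], _, _, σ => σ
  | a :: Γ, _, _, σ => cons a (under Γ σ)

/-- `Γ, Δ ⟶ Γ', Δ`. -/
def append : {Γ Γ' : List β} → Exch Γ Γ' → (Δ : List β) → Exch (Γ ++ Δ) (Γ' ++ Δ)
  | _, _, nil, Δ => refl Δ
  | _, _, cons a σ, Δ => cons a (σ.append Δ)
  | _, _, swap a b Γ, Δ => swap a b (Γ ++ Δ)
  | _, _, trans σ τ, Δ => trans (σ.append Δ) (τ.append Δ)

/-- The same exchange after applying `f` to all entries. -/
def map {γ : Type w} (f : β → γ) : {Γ Δ : List β} → Exch Γ Δ → Exch (Γ.map f) (Δ.map f)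
  | _, _, nil => nil
  | _, _, cons a σ => cons (f a) (σ.map f)
  | _, _, swap a b Γ => swap (f a) (f b) (Γ.map f)
  | _, _, trans σ τ => trans (σ.map f) (τ.map f)

/-- `Γ, a, Δ ⟶ a, Γ, Δ`. -/
def front (a : β) : (Γ Δ : List β) → Exch (Γ ++ a :: Δ) (a :: (Γ ++ Δ))
  | [], Δ => refl (a :: Δ)
  | b :: Γ, Δ => trans (cons b (front a Γ Δ)) (swap b a (Γ ++ Δ))

/-- `a, Γ, Δ ⟶ Γ, a, Δ`. -/
def back (a : β) (Γ Δ : List β) : Exch (a :: (Γ ++ Δ)) (Γ ++ a :: Δ) := (front a Γ Δ).symm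

/-- `Γ, Δ, Θ ⟶ Δ, Γ, Θ`. -/
def block : (Γ Δ Θ : List β) → Exch (Γ ++ (Δ ++ Θ)) (Δ ++ (Γ ++ Θ))
  | [], Δ, Θ => refl (Δ ++ Θ)
  | a :: Γ, Δ, Θ => trans (cons a (block Γ Δ Θ)) (back a Δ (Γ ++ Θ))

/-- Reassociation of contexts (the identity permutation). -/
def assoc (Γ Δ Θ : List β) : Exch ((Γ ++ Δ) ++ Θ) (Γ ++ (Δ ++ Θ)) :=
  ofEq (List.append_assoc Γ Δ Θ)

end Exch

/-! ### Proofs -/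

/-- Proofs of sequents `Γ ⊢ A`. Rules act at the front of the context, which is no restriction
because of the exchange rule. -/
inductive Deriv {α : Type v} : List (Formula α) → Formula α → Type v
  | ax (A : Formula α) : Deriv [A] A
  | cut {Γ Δ : List (Formula α)} {A B : Formula α}
      (π : Deriv Γ A) (ρ : Deriv (A :: Δ) B) : Deriv (Γ ++ Δ) B
  | exch {Γ Δ : List (Formula α)} {A : Formula α} (σ : Exch Γ Δ) (π : Deriv Γ A) : Deriv Δ A
  | tensorR {Γ Δ : List (Formula α)} {A B : Formula α}
      (π : Deriv Γ A) (ρ : Deriv Δ B) : Deriv (Γ ++ Δ) (.tensor A B)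
  | tensorL {Γ : List (Formula α)} {A B C : Formula α}
      (π : Deriv (A :: B :: Γ) C) : Deriv (.tensor A B :: Γ) C
  | lolliR {Γ : List (Formula α)} {A B : Formula α}
      (π : Deriv (A :: Γ) B) : Deriv Γ (.lolli A B)
  | lolliL {Γ Δ : List (Formula α)} {A B C : Formula α}
      (π : Deriv Γ A) (ρ : Deriv (B :: Δ) C) : Deriv (.lolli A B :: (Γ ++ Δ)) C
  | withR {Γ : List (Formula α)} {A B : Formula α}
      (π : Deriv Γ A) (ρ : Deriv Γ B) : Deriv Γ (.wth A B)
  | withL₀ {Γ : List (Formula α)} {A : Formula α} (B : Formula α) {C : Formula α}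
      (π : Deriv (A :: Γ) C) : Deriv (.wth A B :: Γ) C
  | withL₁ {Γ : List (Formula α)} (A : Formula α) {B C : Formula α}
      (π : Deriv (B :: Γ) C) : Deriv (.wth A B :: Γ) C
  | prom {Γ : List (Formula α)} {A : Formula α}
      (π : Deriv (bangs Γ) A) : Deriv (bangs Γ) (.bang A)
  | der {Γ : List (Formula α)} {A B : Formula α}
      (π : Deriv (A :: Γ) B) : Deriv (.bang A :: Γ) B
  | wk {Γ : List (Formula α)} (A : Formula α) {B : Formula α}
      (π : Deriv Γ B) : Deriv (.bang A :: Γ) B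
  | ctr {Γ : List (Formula α)} {A B : Formula α}
      (π : Deriv (.bang A :: .bang A :: Γ) B) : Deriv (.bang A :: Γ) B

namespace Deriv

variable {α : Type v}

/-- The cut of `Γ ⊢ A` against the displayed occurrence of `A` in `Ξ, A, Δ ⊢ B`. -/
def cutAt (Ξ : List (Formula α)) {Γ Δ : List (Formula α)} {A B : Formula α}
    (π : Deriv Γ A) (ρ : Deriv (Ξ ++ A :: Δ) B) : Deriv (Ξ ++ (Γ ++ Δ)) B :=
  exch (.block Γ Ξ Δ) (cut π (exch (.front A Ξ Δ) ρ))

/-- Weakening in all of `!Γ`. -/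
def wks {Δ : List (Formula α)} {B : Formula α} :
    (Γ : List (Formula α)) → Deriv Δ B → Deriv (bangs Γ ++ Δ) B
  | [], π => π
  | A :: Γ, π => wk A (wks Γ π)

/-- Contraction of two copies of `!Γ`. -/
def ctrs {B : Formula α} : (Γ : List (Formula α)) → (Δ : List (Formula α)) →
    Deriv (bangs Γ ++ (bangs Γ ++ Δ)) B → Deriv (bangs Γ ++ Δ) B
  | [], _, π => π
  | A :: Γ, Δ, π =>
    let X := Formula.bang A
    let π₁ : Deriv (X :: X :: (bangs Γ ++ (bangs Γ ++ Δ))) B :=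
      exch (.cons X (.front X (bangs Γ) (bangs Γ ++ Δ))) π
    let π₂ : Deriv (bangs Γ ++ (bangs Γ ++ X :: Δ)) B :=
      exch (.trans (.back X (bangs Γ) (bangs Γ ++ Δ))
        (.under (bangs Γ) (.back X (bangs Γ) Δ))) (ctr π₁)
    exch (.front X (bangs Γ) Δ) (ctrs Γ (X :: Δ) π₂)

end Deriv

open Deriv

/-! ### Equivalence under cut-elimination -/

/-- Equivalence of proofs under cut-elimination: the congruence generated by the cut-elimination
transformations (commuting conversions, `η`-expansions, axiom steps, principal steps, exponential
steps, secondary conclusion and secondary hypothesis steps). Exchanges are treated as bookkeeping: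
only the permutation that they induce matters, and they commute with all rules. -/
inductive CutEquiv {α : Type v} : {Γ : List (Formula α)} → {A : Formula α} →
    Deriv Γ A → Deriv Γ A → Prop
  -- equivalence relation
  | refl {Γ A} (π : Deriv Γ A) : CutEquiv π π
  | symm {Γ A} {π ρ : Deriv Γ A} : CutEquiv π ρ → CutEquiv ρ π
  | trans {Γ A} {π ρ τ : Deriv Γ A} : CutEquiv π ρ → CutEquiv ρ τ → CutEquiv π τ
  -- congruence
  | cut {Γ Δ A B} {π π' : Deriv Γ A} {ρ ρ' : Deriv (A :: Δ) B} :
      CutEquiv π π' → CutEquiv ρ ρ' → CutEquiv (cut π ρ) (cut π' ρ')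
  | exch {Γ Δ A} (σ : Exch Γ Δ) {π π' : Deriv Γ A} :
      CutEquiv π π' → CutEquiv (exch σ π) (exch σ π')
  | tensorR {Γ Δ A B} {π π' : Deriv Γ A} {ρ ρ' : Deriv Δ B} :
      CutEquiv π π' → CutEquiv ρ ρ' → CutEquiv (tensorR π ρ) (tensorR π' ρ')
  | tensorL {Γ A B C} {π π' : Deriv (A :: B :: Γ) C} :
      CutEquiv π π' → CutEquiv (tensorL π) (tensorL π')
  | lolliR {Γ A B} {π π' : Deriv (A :: Γ) B} :
      CutEquiv π π' → CutEquiv (lolliR π) (lolliR π')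
  | lolliL {Γ Δ A B C} {π π' : Deriv Γ A} {ρ ρ' : Deriv (B :: Δ) C} :
      CutEquiv π π' → CutEquiv ρ ρ' → CutEquiv (lolliL π ρ) (lolliL π' ρ')
  | withR {Γ A B} {π π' : Deriv Γ A} {ρ ρ' : Deriv Γ B} :
      CutEquiv π π' → CutEquiv ρ ρ' → CutEquiv (withR π ρ) (withR π' ρ')
  | withL₀ {Γ A} (B) {C} {π π' : Deriv (A :: Γ) C} :
      CutEquiv π π' → CutEquiv (withL₀ B π) (withL₀ B π')
  | withL₁ {Γ} (A) {B C} {π π' : Deriv (B :: Γ) C} :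
      CutEquiv π π' → CutEquiv (withL₁ A π) (withL₁ A π')
  | prom {Γ A} {π π' : Deriv (bangs Γ) A} : CutEquiv π π' → CutEquiv (prom π) (prom π')
  | der {Γ A B} {π π' : Deriv (A :: Γ) B} : CutEquiv π π' → CutEquiv (der π) (der π')
  | wk {Γ} (A) {B} {π π' : Deriv Γ B} : CutEquiv π π' → CutEquiv (wk A π) (wk A π')
  | ctr {Γ A B} {π π' : Deriv (.bang A :: .bang A :: Γ) B} :
      CutEquiv π π' → CutEquiv (ctr π) (ctr π')
  -- exchanges
  | exch_refl {Γ A} (π : Deriv Γ A) : CutEquiv (exch (.refl Γ) π) π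
  | exch_exch {Γ Δ Θ A} (σ : Exch Γ Δ) (τ : Exch Δ Θ) (π : Deriv Γ A) :
      CutEquiv (exch τ (exch σ π)) (exch (.trans σ τ) π)
  | exch_same {Γ Δ A} {σ τ : Exch Γ Δ} (h : σ.Same τ) (π : Deriv Γ A) :
      CutEquiv (exch σ π) (exch τ π)
  | cut_exch_left {Γ Γ' Δ A B} (σ : Exch Γ Γ') (π : Deriv Γ A) (ρ : Deriv (A :: Δ) B) :
      CutEquiv (cut (exch σ π) ρ) (exch (σ.append Δ) (cut π ρ))
  | cut_exch_right {Γ Δ Δ' A B} (σ : Exch Δ Δ') (π : Deriv Γ A) (ρ : Deriv (A :: Δ) B) :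
      CutEquiv (cut π (exch (.cons A σ) ρ)) (exch (.under Γ σ) (cut π ρ))
  | tensorR_exch_left {Γ Γ' Δ A B} (σ : Exch Γ Γ') (π : Deriv Γ A) (ρ : Deriv Δ B) :
      CutEquiv (tensorR (exch σ π) ρ) (exch (σ.append Δ) (tensorR π ρ))
  | tensorR_exch_right {Γ Δ Δ' A B} (σ : Exch Δ Δ') (π : Deriv Γ A) (ρ : Deriv Δ B) :
      CutEquiv (tensorR π (exch σ ρ)) (exch (.under Γ σ) (tensorR π ρ))
  | tensorL_exch {Γ Γ' A B C} (σ : Exch Γ Γ') (π : Deriv (A :: B :: Γ) C) :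
      CutEquiv (tensorL (exch (.cons A (.cons B σ)) π)) (exch (.cons _ σ) (tensorL π))
  | lolliR_exch {Γ Γ' A B} (σ : Exch Γ Γ') (π : Deriv (A :: Γ) B) :
      CutEquiv (lolliR (exch (.cons A σ) π)) (exch σ (lolliR π))
  | lolliL_exch_left {Γ Γ' Δ A B C} (σ : Exch Γ Γ') (π : Deriv Γ A) (ρ : Deriv (B :: Δ) C) :
      CutEquiv (lolliL (exch σ π) ρ) (exch (.cons _ (σ.append Δ)) (lolliL π ρ))
  | lolliL_exch_right {Γ Δ Δ' A B C} (σ : Exch Δ Δ') (π : Deriv Γ A) (ρ : Deriv (B :: Δ) C) :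
      CutEquiv (lolliL π (exch (.cons B σ) ρ)) (exch (.cons _ (.under Γ σ)) (lolliL π ρ))
  | withR_exch {Γ Γ' A B} (σ : Exch Γ Γ') (π : Deriv Γ A) (ρ : Deriv Γ B) :
      CutEquiv (withR (exch σ π) (exch σ ρ)) (exch σ (withR π ρ))
  | withL₀_exch {Γ Γ' A B C} (σ : Exch Γ Γ') (π : Deriv (A :: Γ) C) :
      CutEquiv (withL₀ B (exch (.cons A σ) π)) (exch (.cons _ σ) (withL₀ B π))
  | withL₁_exch {Γ Γ' A B C} (σ : Exch Γ Γ') (π : Deriv (B :: Γ) C) :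
      CutEquiv (withL₁ A (exch (.cons B σ) π)) (exch (.cons _ σ) (withL₁ A π))
  | prom_exch {Γ Γ' A} (σ : Exch Γ Γ') (π : Deriv (bangs Γ) A) :
      CutEquiv (prom (exch (σ.map Formula.bang) π)) (exch (σ.map Formula.bang) (prom π))
  | der_exch {Γ Γ' A B} (σ : Exch Γ Γ') (π : Deriv (A :: Γ) B) :
      CutEquiv (der (exch (.cons A σ) π)) (exch (.cons _ σ) (der π))
  | wk_exch {Γ Γ' A B} (σ : Exch Γ Γ') (π : Deriv Γ B) :
      CutEquiv (wk A (exch σ π)) (exch (.cons _ σ) (wk A π))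
  | ctr_exch {Γ Γ' A B} (σ : Exch Γ Γ') (π : Deriv (.bang A :: .bang A :: Γ) B) :
      CutEquiv (ctr (exch (.cons _ (.cons _ σ)) π)) (exch (.cons _ σ) (ctr π))
  | ctr_swap {Γ A B} (π : Deriv (.bang A :: .bang A :: Γ) B) :
      CutEquiv (ctr (exch (.swap _ _ Γ) π)) (ctr π)
  -- commuting conversions of cuts
  | cut_cut {Γ Δ Θ A B C} (π : Deriv Γ A) (ρ : Deriv (A :: Δ) B) (τ : Deriv (B :: Θ) C) :
      CutEquiv (exch (.assoc Γ Δ Θ) (cut (cut π ρ) τ)) (cut π (cut (Δ := Θ) ρ τ))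
  | cut_cutAt {Γ Δ Θ A B C} (π : Deriv Γ A) (ρ : Deriv Δ B) (τ : Deriv (A :: B :: Θ) C) :
      CutEquiv (cut π (cutAt [A] ρ τ)) (cutAt (Δ := Θ) Γ ρ (cut (Δ := B :: Θ) π τ))
  -- axiom steps
  | ax_cut {Γ A B} (π : Deriv (A :: Γ) B) : CutEquiv (cut (ax A) π) π
  | cut_ax {Γ A} (π : Deriv Γ A) :
      CutEquiv (exch (.ofEq (List.append_nil Γ)) (cut π (ax A))) π
  -- `η`-expansion steps
  | eta_tensor (A B : Formula α) :
      CutEquiv (ax (.tensor A B)) (tensorL (tensorR (ax A) (ax B)))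
  | eta_lolli (A B : Formula α) :
      CutEquiv (ax (.lolli A B)) (lolliR (exch (.swap _ A []) (lolliL (ax A) (ax B))))
  | eta_with (A B : Formula α) :
      CutEquiv (ax (.wth A B)) (withR (withL₀ B (ax A)) (withL₁ A (ax B)))
  | eta_bang (A : Formula α) :
      CutEquiv (ax (.bang A)) (prom (Γ := [A]) (der (ax A)))
  -- principal steps
  | tensor_step {Γ Δ Θ A B C} (π : Deriv Γ A) (ρ : Deriv Δ B) (τ : Deriv (A :: B :: Θ) C) :
      CutEquiv (exch (.assoc Γ Δ Θ) (cut (tensorR π ρ) (tensorL τ))) (cut π (cutAt [A] ρ τ))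
  | lolli_step {Γ Δ Θ A B C} (π : Deriv (A :: Γ) B) (ρ : Deriv Δ A) (τ : Deriv (B :: Θ) C) :
      CutEquiv (exch (.block Γ Δ Θ) (cut (lolliR π) (lolliL ρ τ)))
        (exch (.assoc Δ Γ Θ) (cut (cut ρ π) τ))
  | with_step₀ {Γ Δ A B C} (π : Deriv Γ A) (ρ : Deriv Γ B) (τ : Deriv (A :: Δ) C) :
      CutEquiv (cut (withR π ρ) (withL₀ B τ)) (cut π τ)
  | with_step₁ {Γ Δ A B C} (π : Deriv Γ A) (ρ : Deriv Γ B) (τ : Deriv (B :: Δ) C) :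
      CutEquiv (cut (withR π ρ) (withL₁ A τ)) (cut ρ τ)
  -- exponential steps
  | prom_der {Γ Δ A B} (π : Deriv (bangs Γ) A) (ρ : Deriv (A :: Δ) B) :
      CutEquiv (cut (prom π) (der ρ)) (cut π ρ)
  | prom_wk {Γ Δ A B} (π : Deriv (bangs Γ) A) (ρ : Deriv Δ B) :
      CutEquiv (cut (prom π) (wk A ρ)) (wks Γ ρ)
  | prom_ctr {Γ Δ A B} (π : Deriv (bangs Γ) A) (ρ : Deriv (.bang A :: .bang A :: Δ) B) :
      CutEquiv (cut (prom π) (ctr ρ))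
        (ctrs Γ Δ (cut (prom π) (cutAt [.bang A] (prom π) ρ)))
  | prom_prom {Γ Δ A B} (π : Deriv (bangs Γ) A) (ρ : Deriv (bangs (A :: Δ)) B) :
      CutEquiv (exch (.ofEq List.map_append.symm) (cut (Δ := bangs Δ) (prom π) (prom ρ)))
        (prom (Γ := Γ ++ Δ) (exch (.ofEq List.map_append.symm) (cut (Δ := bangs Δ) (prom π) ρ)))
  -- secondary conclusion steps
  | tensorL_cut {Γ Δ A B C D} (π : Deriv (A :: B :: Γ) C) (ρ : Deriv (C :: Δ) D) :
      CutEquiv (cut (tensorL π) ρ) (tensorL (cut π ρ))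
  | lolliL_cut {Γ Δ Θ A B C D} (π : Deriv Γ A) (ρ : Deriv (B :: Δ) C) (τ : Deriv (C :: Θ) D) :
      CutEquiv (exch (.cons _ (.assoc Γ Δ Θ)) (cut (lolliL π ρ) τ))
        (lolliL (Δ := Δ ++ Θ) π (cut ρ τ))
  | withL₀_cut {Γ Δ A B C D} (π : Deriv (A :: Γ) C) (ρ : Deriv (C :: Δ) D) :
      CutEquiv (cut (withL₀ B π) ρ) (withL₀ B (cut π ρ))
  | withL₁_cut {Γ Δ A B C D} (π : Deriv (B :: Γ) C) (ρ : Deriv (C :: Δ) D) :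
      CutEquiv (cut (withL₁ A π) ρ) (withL₁ A (cut π ρ))
  | der_cut {Γ Δ A B C} (π : Deriv (A :: Γ) B) (ρ : Deriv (B :: Δ) C) :
      CutEquiv (cut (der π) ρ) (der (cut π ρ))
  | wk_cut {Γ Δ A B C} (π : Deriv Γ B) (ρ : Deriv (B :: Δ) C) :
      CutEquiv (cut (wk A π) ρ) (wk A (cut π ρ))
  | ctr_cut {Γ Δ A B C} (π : Deriv (.bang A :: .bang A :: Γ) B) (ρ : Deriv (B :: Δ) C) :
      CutEquiv (cut (ctr π) ρ) (ctr (cut π ρ))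
  -- secondary hypothesis steps
  | cut_tensorR_left {Γ Δ Θ A B C} (π : Deriv Γ A) (ρ : Deriv (A :: Δ) B) (τ : Deriv Θ C) :
      CutEquiv (cut (Δ := Δ ++ Θ) π (tensorR ρ τ))
        (exch (.assoc Γ Δ Θ) (tensorR (cut π ρ) τ))
  | cut_tensorR_right {Γ Δ Θ A B C} (π : Deriv Γ A) (ρ : Deriv Δ B) (τ : Deriv (A :: Θ) C) :
      CutEquiv (cutAt Δ π (tensorR ρ τ)) (tensorR ρ (cut π τ))
  | cut_tensorL {Γ Δ A B C D} (π : Deriv Γ A) (τ : Deriv (B :: C :: A :: Δ) D) :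
      CutEquiv (cutAt [.tensor B C] π (tensorL τ)) (tensorL (cutAt [B, C] π τ))
  | cut_lolliR {Γ Δ A B C} (π : Deriv Γ A) (τ : Deriv (B :: A :: Δ) C) :
      CutEquiv (cut π (lolliR τ)) (lolliR (cutAt [B] π τ))
  | cut_lolliL_left {Γ Δ Θ A B C D} (π : Deriv Γ A) (ρ : Deriv (A :: Δ) B)
      (τ : Deriv (C :: Θ) D) :
      CutEquiv (cutAt [.lolli B C] (Δ := Δ ++ Θ) π (lolliL (Γ := A :: Δ) (Δ := Θ) ρ τ))
        (exch (.cons _ (.assoc Γ Δ Θ)) (lolliL (cut π ρ) τ))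
  | cut_lolliL_right {Γ Δ Θ A B C D} (π : Deriv Γ A) (ρ : Deriv Δ B)
      (τ : Deriv (C :: A :: Θ) D) :
      CutEquiv (cutAt (.lolli B C :: Δ) π (lolliL ρ τ)) (lolliL ρ (cutAt [C] π τ))
  | cut_withR {Γ Δ A B C} (π : Deriv Γ A) (ρ : Deriv (A :: Δ) B) (τ : Deriv (A :: Δ) C) :
      CutEquiv (cut π (withR ρ τ)) (withR (cut π ρ) (cut π τ))
  | cut_withL₀ {Γ Δ A B C D} (π : Deriv Γ A) (τ : Deriv (B :: A :: Δ) D) :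
      CutEquiv (cutAt [.wth B C] π (withL₀ C τ)) (withL₀ C (cutAt [B] π τ))
  | cut_withL₁ {Γ Δ A B C D} (π : Deriv Γ A) (τ : Deriv (C :: A :: Δ) D) :
      CutEquiv (cutAt [.wth B C] π (withL₁ B τ)) (withL₁ B (cutAt [C] π τ))
  | cut_der {Γ Δ A B C} (π : Deriv Γ A) (τ : Deriv (B :: A :: Δ) C) :
      CutEquiv (cutAt [.bang B] π (der τ)) (der (cutAt [B] π τ))
  | cut_wk {Γ Δ A B C} (π : Deriv Γ A) (τ : Deriv (A :: Δ) C) :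
      CutEquiv (cutAt (Γ := Γ) (Δ := Δ) [.bang B] π (wk (Γ := A :: Δ) B τ))
        (wk B (cut (Γ := Γ) (Δ := Δ) π τ))
  | cut_ctr {Γ Δ A B C} (π : Deriv Γ A) (τ : Deriv (.bang B :: .bang B :: A :: Δ) C) :
      CutEquiv (cutAt [.bang B] π (ctr τ)) (ctr (cutAt [.bang B, .bang B] π τ))

/-! ### Plain and component-wise plain proofs -/

variable {α : Type v}

/-- `n₁ A₁, …, nᵣ Aᵣ` for `Γ = A₁, …, Aᵣ`. -/
def expand : (Γ : List (Formula α)) → (Fin Γ.length → ℕ) → List (Formula α)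
  | [], _ => []
  | A :: Γ, n => List.replicate (n 0) A ++ expand Γ (fun i => n i.succ)

/-- Dereliction of all hypotheses in `Γ`. -/
def ders {B : Formula α} : (Γ Δ : List (Formula α)) → Deriv (Γ ++ Δ) B → Deriv (bangs Γ ++ Δ) B
  | [], _, π => π
  | A :: Γ, Δ, π =>
    exch (.front _ (bangs Γ) Δ) (ders Γ (.bang A :: Δ) (exch (.back _ Γ Δ) (der π)))

/-- From `n !A, Δ ⊢ B` to `!A, Δ ⊢ B`, by a weakening if `n = 0` and `n - 1` contractions
otherwise. -/
def merge {A B : Formula α} {Δ : List (Formula α)} : (n : ℕ) →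
    Deriv (List.replicate n (.bang A) ++ Δ) B → Deriv (.bang A :: Δ) B
  | 0, π => wk A π
  | 1, π => π
  | n + 2, π => merge (n + 1) (ctr π)

/-- From `n₁ !A₁, …, nᵣ !Aᵣ, Δ ⊢ B` to `!A₁, …, !Aᵣ, Δ ⊢ B`. -/
def merges {B : Formula α} : (Γ : List (Formula α)) → (n : Fin Γ.length → ℕ) →
    (Δ : List (Formula α)) → Deriv (bangs (expand Γ n) ++ Δ) B → Deriv (bangs Γ ++ Δ) B
  | [], _, _, π => π
  | A :: Γ, n, Δ, π =>
    let n' : Fin Γ.length → ℕ := fun i => n i.succ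
    let π₁ : Deriv (List.replicate (n 0) (.bang A) ++ (bangs (expand Γ n') ++ Δ)) B :=
      exch (.ofEq (by simp [expand, n'])) π
    exch (.front _ (bangs Γ) Δ)
      (merges Γ n' (.bang A :: Δ) (exch (.back _ (bangs (expand Γ n')) Δ) (merge (n 0) π₁)))

/-- The proof of `!A₁, …, !Aᵣ ⊢ B` obtained from `n₁ A₁, …, nᵣ Aᵣ ⊢ B` by derelictions followed
by contractions and weakenings. -/
def plainForm {Γ : List (Formula α)} {B : Formula α} (n : Fin Γ.length → ℕ)
    (π : Deriv (expand Γ n) B) : Deriv (bangs Γ) B :=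
  exch (.ofEq (List.append_nil _)) (merges Γ n []
    (ders (expand Γ n) [] (exch (.ofEq (List.append_nil _).symm) π)))

/-- A proof of `!A₁, …, !Aᵣ ⊢ B` is plain if it is equivalent under cut-elimination to one obtained
from some proof of `n₁ A₁, …, nᵣ Aᵣ ⊢ B` by derelictions, contractions and weakenings. -/
def IsPlain {Γ : List (Formula α)} {B : Formula α} (ψ : Deriv (bangs Γ) B) : Prop :=
  ∃ (n : Fin Γ.length → ℕ) (π : Deriv (expand Γ n) B), CutEquiv ψ (plainForm n π)

/-- `m` copies of `!Γ`. -/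
def copies (Γ : List (Formula α)) : ℕ → List (Formula α)
  | 0 => []
  | m + 1 => bangs Γ ++ copies Γ m

/-- The tensor product of the promotions of proofs of `!Γ ⊢ Bᵢ`. -/
def tensorProm {Γ : List (Formula α)} : (L : List (Formula α)) → {B : Formula α} →
    Tuple (fun C => Deriv (bangs Γ) C) L → Deriv (bangs Γ) B →
    Deriv (copies Γ (L.length + 1)) (bangTensor L B)
  | [], _, _, ψ => exch (.ofEq (List.append_nil _).symm) (prom ψ)
  | _ :: L, _, ψs, ψ => tensorR (prom ψs.1) (tensorProm L ψs.2 ψ)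

/-- Contraction of `m + 1` copies of `!Γ` to one. -/
def ctrCopies {Γ : List (Formula α)} {B : Formula α} : (m : ℕ) →
    Deriv (copies Γ (m + 1)) B → Deriv (bangs Γ) B
  | 0, π => exch (.ofEq (List.append_nil _)) π
  | m + 1, π => ctrCopies m (ctrs Γ (copies Γ m) π)

/-- The proofs underlying a family of plain proofs. -/
def forgetPlain {Γ : List (Formula α)} : (L : List (Formula α)) →
    Tuple (fun C => {φ : Deriv (bangs Γ) C // IsPlain φ}) L →
    Tuple (fun C => Deriv (bangs Γ) C) L
  | [], _ => ⟨⟩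
  | _ :: L, ψs => (ψs.1.1, forgetPlain L ψs.2)

/-- A proof of `!A₁, …, !Aᵣ ⊢ !B₁ ⊗ ⋯ ⊗ !Bₛ` is component-wise plain if it is equivalent under
cut-elimination to the tensor product of the promotions of plain proofs `ψᵢ` of
`!A₁, …, !Aᵣ ⊢ Bᵢ`, followed by contractions. -/
def IsComponentwisePlain {Γ L : List (Formula α)} {B : Formula α}
    (ψ : Deriv (bangs Γ) (bangTensor L B)) : Prop :=
  ∃ (ψs : Tuple (fun C => {φ : Deriv (bangs Γ) C // IsPlain φ}) L)
    (ψ₀ : Deriv (bangs Γ) B), IsPlain ψ₀ ∧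
      CutEquiv ψ (ctrCopies L.length (tensorProm L (forgetPlain L ψs) ψ₀))

/-- The left tensor rules, from `!A₁, …, !Aᵣ, !B, Δ ⊢ C` to `!A₁ ⊗ ⋯ ⊗ !Aᵣ ⊗ !B, Δ ⊢ C`. -/
def tensorLs {B C : Formula α} : (L Δ : List (Formula α)) →
    Deriv (bangs (L ++ [B]) ++ Δ) C → Deriv (bangTensor L B :: Δ) C
  | [], _, π => π
  | A :: L, Δ, π => tensorL (exch (.swap _ _ Δ)
      (tensorLs L (.bang A :: Δ) (exch (.back (.bang A) (bangs (L ++ [B])) Δ) π)))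

/-- Component-wise plain proofs of `!A₁ ⊗ ⋯ ⊗ !Aᵣ ⊢ !B₁ ⊗ ⋯ ⊗ !Bₛ`: the left tensor rules applied
to a component-wise plain proof of `!A₁, …, !Aᵣ ⊢ !B₁ ⊗ ⋯ ⊗ !Bₛ`. -/
def IsComponentwisePlainTensor {L L' : List (Formula α)} {B B' : Formula α}
    (φ : Deriv [bangTensor L B] (bangTensor L' B')) : Prop :=
  ∃ ψ : Deriv (bangs (L ++ [B])) (bangTensor L' B'), IsComponentwisePlain ψ ∧
    CutEquiv φ (tensorLs L [] (exch (.ofEq (List.append_nil _).symm) ψ))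

/-! ### Encoding of data -/

/-- The proof of `Aⁿ ⊢ A` selecting the `i`-th copy. -/
def select (A : Formula α) : (n : ℕ) → Fin n → Deriv [power A n] A
  | 0, i => i.elim0
  | 1, _ => ax A
  | n + 2, i => Fin.cases (withL₀ _ (ax A)) (fun j => withL₁ A (select A (n + 1) j)) i

/-- The `n`-boolean `i`, a proof of `⊢ Aⁿ ⊸ A`. -/
def numeral (A : Formula α) {n : ℕ} (i : Fin n) : Deriv [] (nbool A n) := lolliR (select A n i)

/-- The tensor product of the promotions of closed proofs. -/
def closedTensor : (L : List (Formula α)) → {B : Formula α} →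
    Tuple (fun C => Deriv [] C) L → Deriv [] B → Deriv [] (bangTensor L B)
  | [], _, _, π => prom (Γ := []) π
  | _ :: L, _, πs, π => tensorR (prom (Γ := []) πs.1) (closedTensor L πs.2 π)

/-- The types of the `h` tape squares and the state: `h` copies of `ₛbool`, then `ₙbool`. -/
abbrev tapeState (A : Formula α) (s n h : ℕ) : List (Formula α) :=
  List.replicate h (nbool A s) ++ [nbool A n]

/-- The formula `!ₛbool^{⊗h} ⊗ !ₙbool ⊗ !ₕbool`. -/
abbrev absConfig (A : Formula α) (s n h : ℕ) : Formula α :=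
  bangTensor (tapeState A s n h) (nbool A h)

/-- Assemble `h` tape squares and a state. -/
def tapeTuple {β : Type v} {f : β → Type w} {S N : β} : (h : ℕ) → (Fin h → f S) → f N →
    Tuple f (List.replicate h S ++ [N])
  | 0, _, y => (y, ⟨⟩)
  | h + 1, x, y => (x 0, tapeTuple h (fun i => x i.succ) y)

/-! ### Turing machines on a cyclic tape -/

/-- Head movements. -/
inductive Dir
  | left
  | right

/-- The head position, modulo `h`, after moving from `p` in direction `d`. -/
def Dir.move {h : ℕ} [NeZero h] (p : Fin h) : Dir → Fin h
  | left => p - 1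
  | right => p + 1

/-- Configurations of a machine with symbols `Fin s` and states `Fin n` on a tape of length `h`. -/
structure Config (s n h : ℕ) where
  tape : Fin h → Fin s
  state : Fin n
  head : Fin h

/-- One step of the machine with transition function `δ`. -/
def Config.step {s n h : ℕ} [NeZero h] (δ : Fin s × Fin n → Fin s × Fin n × Dir)
    (c : Config s n h) : Config s n h where
  tape := Function.update c.tape c.head (δ (c.tape c.head, c.state)).1
  state := (δ (c.tape c.head, c.state)).2.1
  head := (δ (c.tape c.head, c.state)).2.2.move c.head

/-- The proof of `⊢ !ₛbool^{⊗h} ⊗ !ₙbool ⊗ !ₕbool` representing a configuration. -/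
def Config.proof (A : Formula α) {s n h : ℕ} (c : Config s n h) :
    Deriv [] (absConfig A s n h) :=
  closedTensor (tapeState A s n h)
    (tapeTuple h (fun m => numeral A (c.tape m)) (numeral A c.state)) (numeral A c.head)

/-! ### Sweedler semantics -/

section Semantics

open scoped TensorProduct
open Sweedler

variable (k : Type u) [Field k] (v : α → ModuleCat.{u} k)

/-- The denotation of a formula. -/
noncomputable def den : Formula α → ModuleCat.{u} k
  | .atom x => v x
  | .tensor A B => ModuleCat.of k (den A ⊗[k] den B)
  | .wth A B => ModuleCat.of k (den A × den B)
  | .lolli A B => ModuleCat.of k (den A →ₗ[k] den B)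
  | .bang A => ModuleCat.of k (Bang k (den A))

/-- The denotation `⟦A₁⟧ ⊗ (⟦A₂⟧ ⊗ ⋯ ⊗ k)` of a context. -/
noncomputable def denCtx : List (Formula α) → ModuleCat.{u} k
  | [] => ModuleCat.of k k
  | A :: Γ => ModuleCat.of k (den k v A ⊗[k] denCtx Γ)

/-- `⟦Γ, Δ⟧ ≅ ⟦Γ⟧ ⊗ ⟦Δ⟧`. -/
noncomputable def split : (Γ Δ : List (Formula α)) →
    (denCtx k v (Γ ++ Δ) ≃ₗ[k] denCtx k v Γ ⊗[k] denCtx k v Δ)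
  | [], Δ => (TensorProduct.lid k (denCtx k v Δ)).symm
  | A :: Γ, Δ =>
    (TensorProduct.congr (LinearEquiv.refl k (den k v A)) (split Γ Δ)).trans
      (TensorProduct.assoc k (den k v A) (denCtx k v Γ) (denCtx k v Δ)).symm

/-- The denotation of an exchange. -/
noncomputable def denExch : {Γ Δ : List (Formula α)} → Exch Γ Δ →
    (denCtx k v Γ ≃ₗ[k] denCtx k v Δ)
  | _, _, .nil => LinearEquiv.refl k _
  | _, _, .cons A σ => TensorProduct.congr (LinearEquiv.refl k (den k v A)) (denExch σ)
  | _, _, .swap A B Γ =>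
    TensorProduct.leftComm k (den k v A) (den k v B) (denCtx k v Γ)
  | _, _, .trans σ τ => (denExch σ).trans (denExch τ)

/-- The coalgebra structure on `⟦!Γ⟧`. -/
noncomputable def ctxCoalgebra : (Γ : List (Formula α)) → Coalgebra k (denCtx k v (bangs Γ))
  | [] => inferInstanceAs (Coalgebra k k)
  | A :: Γ =>
    letI := ctxCoalgebra Γ
    inferInstanceAs (Coalgebra k (Bang k (den k v A) ⊗[k] denCtx k v (bangs Γ)))

theorem ctxCocomm : (Γ : List (Formula α)) →
    letI := ctxCoalgebra k v Γ
    Coalgebra.IsCocomm k (denCtx k v (bangs Γ))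
  | [] => inferInstanceAs (Coalgebra.IsCocomm k k)
  | A :: Γ =>
    letI := ctxCoalgebra k v Γ
    haveI := ctxCocomm Γ
    inferInstanceAs (Coalgebra.IsCocomm k (Bang k (den k v A) ⊗[k] denCtx k v (bangs Γ)))

/-- The denotation of a proof of `Γ ⊢ A`, a linear map `⟦Γ⟧ → ⟦A⟧`. -/
noncomputable def denote : {Γ : List (Formula α)} → {A : Formula α} → Deriv Γ A →
    (denCtx k v Γ →ₗ[k] den k v A)
  | _, _, .ax A => (TensorProduct.rid k (den k v A)).toLinearMap
  | _, _, .cut (Γ := Γ) (Δ := Δ) π ρ =>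
    denote ρ ∘ₗ LinearMap.rTensor (denCtx k v Δ) (denote π) ∘ₗ (split k v Γ Δ).toLinearMap
  | _, _, .exch σ π => denote π ∘ₗ (denExch k v σ).symm.toLinearMap
  | _, _, .tensorR (Γ := Γ) (Δ := Δ) π ρ =>
    TensorProduct.map (denote π) (denote ρ) ∘ₗ (split k v Γ Δ).toLinearMap
  | _, _, .tensorL (Γ := Γ) (A := A) (B := B) π =>
    denote π ∘ₗ (TensorProduct.assoc k (den k v A) (den k v B) (denCtx k v Γ)).toLinearMap
  | _, _, .lolliR π => (TensorProduct.curry (denote π)).flip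
  | _, _, .lolliL (Γ := Γ) (Δ := Δ) (A := A) (B := B) π ρ =>
    denote ρ ∘ₗ
      LinearMap.rTensor (denCtx k v Δ)
        (TensorProduct.lift (LinearMap.id : (den k v A →ₗ[k] den k v B) →ₗ[k] _) ∘ₗ
          LinearMap.lTensor (den k v A →ₗ[k] den k v B) (denote π)) ∘ₗ
      (TensorProduct.assoc k (den k v A →ₗ[k] den k v B) (denCtx k v Γ)
        (denCtx k v Δ)).symm.toLinearMap ∘ₗ
      LinearMap.lTensor (den k v A →ₗ[k] den k v B) (split k v Γ Δ).toLinearMap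
  | _, _, .withR π ρ => (denote π).prod (denote ρ)
  | _, _, .withL₀ (Γ := Γ) (A := A) B π =>
    denote π ∘ₗ LinearMap.rTensor (denCtx k v Γ) (LinearMap.fst k (den k v A) (den k v B))
  | _, _, .withL₁ (Γ := Γ) A (B := B) π =>
    denote π ∘ₗ LinearMap.rTensor (denCtx k v Γ) (LinearMap.snd k (den k v A) (den k v B))
  | _, _, .prom (Γ := Γ) π =>
    letI := ctxCoalgebra k v Γ
    haveI := ctxCocomm k v Γ
    (Bang.lift (denote π)).toLinearMap
  | _, _, .der (Γ := Γ) (A := A) π =>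
    denote π ∘ₗ LinearMap.rTensor (denCtx k v Γ) (Bang.der k (den k v A))
  | _, _, .wk (Γ := Γ) A π =>
    denote π ∘ₗ (TensorProduct.lid k (denCtx k v Γ)).toLinearMap ∘ₗ
      LinearMap.rTensor (denCtx k v Γ) (Coalgebra.counit (R := k) (A := Bang k (den k v A)))
  | _, _, .ctr (Γ := Γ) (A := A) π =>
    denote π ∘ₗ
      (TensorProduct.assoc k (Bang k (den k v A)) (Bang k (den k v A))
        (denCtx k v Γ)).toLinearMap ∘ₗ
      LinearMap.rTensor (denCtx k v Γ) (Coalgebra.comul (R := k) (A := Bang k (den k v A)))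

/-- The denotation of a proof of `A ⊢ B` as a linear map `⟦A⟧ → ⟦B⟧`. -/
noncomputable def denoteMap {A B : Formula α} (π : Deriv [A] B) : den k v A →ₗ[k] den k v B :=
  denote k v π ∘ₗ (TensorProduct.rid k (den k v A)).symm.toLinearMap

/-- The denotation of a proof of `⊢ A` as an element of `⟦A⟧`. -/
noncomputable def denoteElt {A : Formula α} (π : Deriv [] A) : den k v A :=
  denote k v π (1 : k)

/-- `|∅⟩_{x₁} ⊗ ⋯ ⊗ |∅⟩_{xᵣ} ⊗ |∅⟩_y`. -/
noncomputable def vacTensor : (L : List (Formula α)) → {B : Formula α} →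
    Tuple (fun C => den k v C) L → den k v B → den k v (bangTensor L B)
  | [], B, _, y => Bang.vac (k := k) (V := den k v B) y
  | A :: L, B, xs, y =>
    (Bang.vac (k := k) (V := den k v A) xs.1 ⊗ₜ[k] vacTensor L xs.2 y :
      Bang k (den k v A) ⊗[k] den k v (bangTensor L B))

/-! The vectors `∑ i, a i • ⟦i⟧` and the vectors computed by one step. -/

section Vectors

variable (A : Formula α)

/-- The denotation of the `m`-boolean `i`. -/
noncomputable abbrev num {m : ℕ} (i : Fin m) : den k v (nbool A m) := denoteElt k v (numeral A i)

/-- `∑ᵢ aᵢ ⟦i⟧`. -/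
noncomputable def comb {m : ℕ} (a : Fin m → k) : den k v (nbool A m) := ∑ i, a i • num k v A i

variable {s n h : ℕ} [NeZero h] (δ : Fin s × Fin n → Fin s × Fin n × Dir)
  (a : Fin h → Fin s → k) (b : Fin n → k) (c : Fin h → k)

/-- The vector for the new symbol in position `m`. -/
noncomputable def symbolVec (m : Fin h) : den k v (nbool A s) :=
  ∑ i : Fin s, ∑ q : Fin n, (a m i * b q) •
    (c m • num k v A (δ (i, q)).1 + ∑ l ∈ Finset.univ.erase m, c l • num k v A i)

/-- The vector for the new state. -/
noncomputable def stateVec : den k v (nbool A n) :=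
  ∑ i : Fin h → Fin s, ∑ q : Fin n, ∑ l : Fin h,
    ((∏ m, a m (i m)) * b q * c l) • num k v A (δ (i l, q)).2.1

/-- The vector for the new head position. -/
noncomputable def headVec : den k v (nbool A h) :=
  ∑ i : Fin h → Fin s, ∑ q : Fin n, ∑ p : Fin h, ∑ l : Fin h,
    ((∏ m, a m (i m)) * b q * c p * c l) • num k v A ((δ (i l, q)).2.2.move p)

end Vectors

end Semantics

end ILL

open ILL

/-! The new content of every component depends on only finitely many booleans, so each component can
be computed by a complete case distinction. By the right `&`-rule a family of proofs of `Γ ⊢ A`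
combines into a proof of `Γ ⊢ Aᵐ`, and feeding this to an `m`-boolean by the left `⊸`-rule selects a
branch (`caseBool`). Iterating over several hypotheses and closing with the right `⊸`-rule gives
`table`, a linear proof realizing an arbitrary function of boolean values. Derelictions,
contractions and weakenings turn it into a plain proof; `absstep` is the tensor product of the
promotions of such proofs, contracted, under the left `⊗`-rules. It is therefore component-wise
plain by construction.

The multiplicities determine the shape of the polynomials. The symbol at `m` uses square `m`, the
state and the head once each, and weakens all other squares, so their coefficients are absent from
its formula. The new state inspects every square once, because the square under the head is not
known in advance; each square not selected leaves the sum of its coefficients as a factor. The new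
head position uses the old one twice, once to be moved and once to select a square, whence the
product of two coefficients of `γ`.

The remaining two claims are the same computation in two interpretations. A `Model` evaluates proofs
at tuples of elements, with just enough axioms to follow the structural part of `absstep`. One model
consists of closed proofs modulo cut-elimination, evaluated by cuts (`cutModel`). The other consists
of vectors, with `bang` sending a vector to its vacuum vector (`denModel`); its axioms hold because
vacuum vectors are group-like and, by `Bang.eq_vac`, a group-like element is determined by the
vector under it. In any model `eval_absstep` reduces the step to the values of the tables. At
numerals, cut-elimination selects the branch of the given values (`eval_table`). At linear
combinations of numerals, multilinearity gives a sum over all branches, in which different copies of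
one hypothesis take values independently (`denote_table`). The factored forms of `μ` and `ν` then
follow from distributivity (`sum_prod_smul_apply`). -/

namespace ILL

universe u v w w'

/-! ### Tuples -/

namespace Tuple

variable {β : Type v} {f : β → Type w} {g : β → Type w'}

/-- Concatenation of tuples. -/
def append : {Γ Δ : List β} → Tuple f Γ → Tuple f Δ → Tuple f (Γ ++ Δ)
  | [], _, _, ys => ys
  | _ :: _, _, xs, ys => (xs.1, append xs.2 ys)

/-- The tuple with one more entry at the end. -/
def snoc {B : β} : {L : List β} → Tuple f L → f B → Tuple f (L ++ [B])
  | [], _, y => (y, ⟨⟩)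
  | _ :: _, xs, y => (xs.1, snoc xs.2 y)

/-- The constant tuple. -/
def replicate {a : β} (x : f a) : (n : ℕ) → Tuple f (List.replicate n a)
  | 0 => ⟨⟩
  | n + 1 => (x, replicate x n)

/-- Entrywise application of a map. -/
def map (F : ∀ a, f a → g a) : {Γ : List β} → Tuple f Γ → Tuple g Γ
  | [], _ => ⟨⟩
  | _ :: _, xs => (F _ xs.1, map F xs.2)

/-- Entrywise application of a map to the banged entries. -/
def bangs {α : Type v} {f : Formula α → Type w} (F : ∀ {A}, f A → f (.bang A)) :
    {Γ : List (Formula α)} → Tuple f Γ → Tuple f (ILL.bangs Γ)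
  | [], _ => ⟨⟩
  | _ :: _, xs => (F xs.1, bangs (f := f) F xs.2)

/-- Two tuples are entrywise related. -/
def Rel (r : ∀ a, f a → g a → Prop) : {Γ : List β} → Tuple f Γ → Tuple g Γ → Prop
  | [], _, _ => True
  | _ :: _, xs, ys => r _ xs.1 ys.1 ∧ Rel r xs.2 ys.2

theorem map_tapeTuple (F : ∀ a, f a → g a) {S N : β} :
    (h : ℕ) → (x : Fin h → f S) → (y : f N) →
      map F (tapeTuple h x y) = tapeTuple h (fun m => F S (x m)) (F N y)
  | 0, _, _ => rfl
  | h + 1, _, _ => congrArg (Prod.mk _) (map_tapeTuple F h _ _)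

theorem Rel.tapeTuple {r : ∀ a, f a → g a → Prop} {S N : β} :
    (h : ℕ) → {x : Fin h → f S} → {x' : Fin h → g S} → {y : f N} → {y' : g N} →
      (∀ m, r S (x m) (x' m)) → r N y y' →
        Rel r (ILL.tapeTuple h x y) (ILL.tapeTuple h x' y')
  | 0, _, _, _, _, _, hy => ⟨hy, trivial⟩
  | h + 1, _, _, _, _, hx, hy => ⟨hx 0, Rel.tapeTuple h (fun m => hx m.succ) hy⟩

end Tuple

/-! ### Exchanges acting on tuples of arguments. -/

namespace Exch

variable {β : Type v} {f : β → Type w}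

/-- The action of an exchange on tuples, backwards. -/
def pull : {Γ Δ : List β} → Exch Γ Δ → Tuple f Δ → Tuple f Γ
  | _, _, nil, xs => xs
  | _, _, cons _ σ, xs => (xs.1, σ.pull xs.2)
  | _, _, swap _ _ _, xs => (xs.2.1, xs.1, xs.2.2)
  | _, _, trans σ τ, xs => σ.pull (τ.pull xs)

theorem pull_refl : (Γ : List β) → (xs : Tuple f Γ) → (refl Γ).pull xs = xs
  | [], _ => rfl
  | _ :: Γ, xs => congrArg (Prod.mk xs.1) (pull_refl Γ xs.2)

theorem pull_pull_symm : {Γ Δ : List β} → (σ : Exch Γ Δ) → (xs : Tuple f Γ) →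
    σ.pull (σ.symm.pull xs) = xs
  | _, _, nil, _ => rfl
  | _, _, cons _ σ, xs => congrArg (Prod.mk xs.1) (pull_pull_symm σ xs.2)
  | _, _, swap _ _ _, _ => rfl
  | _, _, trans σ τ, xs => by
    simp only [pull, symm, pull_pull_symm τ, pull_pull_symm σ]

theorem pull_symm_pull : {Γ Δ : List β} → (σ : Exch Γ Δ) → (xs : Tuple f Δ) →
    σ.symm.pull (σ.pull xs) = xs
  | _, _, nil, _ => rfl
  | _, _, cons _ σ, xs => congrArg (Prod.mk xs.1) (pull_symm_pull σ xs.2)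
  | _, _, swap _ _ _, _ => rfl
  | _, _, trans σ τ, xs => by
    simp only [pull, symm, pull_symm_pull σ, pull_symm_pull τ]

theorem ofEq_cons (a : β) {Γ Δ : List β} (h : Γ = Δ) (h' : a :: Γ = a :: Δ) :
    ofEq h' = cons a (ofEq h) := by
  subst h
  rfl

/-- The identity `Γ ++ [] = Γ` is not definitional for variable `Γ`, so the transport along it is
peeled off one entry at a time with `ofEq_cons`. -/
theorem pull_ofEq_append_nil : {Γ : List β} → (h : Γ ++ [] = Γ) → (xs : Tuple f Γ) →
    (ofEq h).pull xs = xs.append (Δ := []) ⟨⟩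
  | [], _, _ => rfl
  | a :: Γ, h, xs => by
    rw [ofEq_cons a (List.append_nil Γ) h]
    exact congrArg (Prod.mk xs.1) (pull_ofEq_append_nil _ xs.2)

theorem symm_refl : (Γ : List β) → (refl Γ).symm = refl Γ
  | [] => rfl
  | a :: Γ => congrArg (cons a) (symm_refl Γ)

theorem symm_ofEq {Γ Δ : List β} (h : Γ = Δ) : (ofEq h).symm = ofEq h.symm := by
  subst h
  exact symm_refl Γ

theorem pull_ofEq_append_nil_symm {Γ : List β} (h : Γ = Γ ++ []) (xs : Tuple f Γ) :
    (ofEq h).pull (xs.append (Δ := []) ⟨⟩) = xs := by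
  rw [← pull_ofEq_append_nil h.symm, ← symm_ofEq h, pull_pull_symm]

theorem pull_front (a : β) : (Γ Δ : List β) → (x : f a) → (xs : Tuple f Γ) → (ys : Tuple f Δ) →
    (front a Γ Δ).pull (f := f) (x, xs.append ys) = xs.append (Δ := a :: Δ) (x, ys)
  | [], Δ, x, _, ys => pull_refl (a :: Δ) (x, ys)
  | _ :: Γ, Δ, x, xs, ys => congrArg (Prod.mk xs.1) (pull_front a Γ Δ x xs.2 ys)

theorem pull_back (a : β) (Γ Δ : List β) (x : f a) (xs : Tuple f Γ) (ys : Tuple f Δ) :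
    (back a Γ Δ).pull (xs.append (Δ := a :: Δ) (x, ys)) = (x, xs.append ys) := by
  rw [← pull_front]
  exact pull_symm_pull (front a Γ Δ) (x, xs.append ys)

theorem pull_under : (Γ : List β) → {Δ Δ' : List β} → (σ : Exch Δ Δ') → (xs : Tuple f Γ) →
    (ys : Tuple f Δ') → (under Γ σ).pull (xs.append ys) = xs.append (σ.pull ys)
  | [], _, _, _, _, _ => rfl
  | _ :: Γ, _, _, σ, xs, ys => congrArg (Prod.mk xs.1) (pull_under Γ σ xs.2 ys)

end Exch

/-! ### Evaluation of proofs at tuples of elements -/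

/-- An interpretation of formulas as types and of proofs as functions of several arguments. -/
structure Model (α : Type v) where
  El : Formula α → Type w
  rel : ∀ {A}, El A → El A → Prop
  rel_refl : ∀ {A} (x : El A), rel x x
  rel_trans : ∀ {A} {x y z : El A}, rel x y → rel y z → rel x z
  bang : ∀ {A}, El A → El (.bang A)
  bang_congr : ∀ {A} {x y : El A}, rel x y → rel (bang x) (bang y)
  pair : ∀ {A B}, El A → El B → El (.tensor A B)
  pair_congr : ∀ {A B} {x x' : El A} {y y' : El B}, rel x x' → rel y y' →
    rel (pair x y) (pair x' y')
  eval : ∀ {Γ B}, Tuple El Γ → Deriv Γ B → El B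
  -- The axioms cover exactly the rules from which `plainForm`, `tensorProm`, `ctrCopies` and
  -- `tensorLs` are built. The exponential rules are only required at arguments of the form `bang
  -- x`; cut, `⊸` and `&` occur only inside the tables and are treated in each model separately.
  eval_exch : ∀ {Γ Δ B} (σ : Exch Γ Δ) (xs : Tuple El Δ) (π : Deriv Γ B),
    rel (eval xs (.exch σ π)) (eval (σ.pull xs) π)
  eval_tensorL : ∀ {Γ A B C} (x : El A) (y : El B) (xs : Tuple El Γ) (π : Deriv (A :: B :: Γ) C),
    rel (eval (Γ := _ :: Γ) (pair x y, xs) (.tensorL π)) (eval (Γ := A :: B :: Γ) (x, y, xs) π)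
  eval_tensorR : ∀ {Γ Δ A B} (xs : Tuple El Γ) (ys : Tuple El Δ) (π : Deriv Γ A) (ρ : Deriv Δ B),
    rel (eval (xs.append ys) (.tensorR π ρ)) (pair (eval xs π) (eval ys ρ))
  eval_der : ∀ {Γ A B} (x : El A) (xs : Tuple El Γ) (π : Deriv (A :: Γ) B),
    rel (eval (Γ := _ :: Γ) (bang x, xs) (.der π)) (eval (Γ := A :: Γ) (x, xs) π)
  eval_wk : ∀ {Γ A B} (x : El A) (xs : Tuple El Γ) (π : Deriv Γ B),
    rel (eval (Γ := _ :: Γ) (bang x, xs) (.wk A π)) (eval xs π)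
  eval_ctr : ∀ {Γ A B} (x : El A) (xs : Tuple El Γ) (π : Deriv (.bang A :: .bang A :: Γ) B),
    rel (eval (Γ := _ :: Γ) (bang x, xs) (.ctr π))
      (eval (Γ := .bang A :: .bang A :: Γ) (bang x, bang x, xs) π)
  eval_prom : ∀ {Γ A} (xs : Tuple El Γ) (π : Deriv (ILL.bangs Γ) A),
    rel (eval (xs.bangs (f := El) bang) (.prom π)) (bang (eval (xs.bangs (f := El) bang) π))

/-! ### The structural part of a component-wise plain proof, in an arbitrary model. -/

namespace Model

variable {α : Type v} (M : Model.{v, w} α)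

/-- The banged tuple. -/
def bangs {Γ : List (Formula α)} (xs : Tuple M.El Γ) : Tuple M.El (ILL.bangs Γ) :=
  xs.bangs (f := M.El) M.bang

/-- `n₁` copies of the first entry, and so on. -/
def expand : {Γ : List (Formula α)} → Tuple M.El Γ → (n : Fin Γ.length → ℕ) →
    Tuple M.El (ILL.expand Γ n)
  | [], _, _ => ⟨⟩
  | _ :: _, xs, n => (Tuple.replicate xs.1 (n 0)).append (expand xs.2 fun i => n i.succ)

/-- `m` copies of the banged tuple. -/
def copies {Γ : List (Formula α)} (xs : Tuple M.El Γ) : (m : ℕ) → Tuple M.El (ILL.copies Γ m)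
  | 0 => ⟨⟩
  | m + 1 => (M.bangs xs).append (copies xs m)

/-- `!x₁ ⊗ ⋯ ⊗ !xᵣ ⊗ !y`. -/
def tensor : (L : List (Formula α)) → {B : Formula α} → Tuple M.El L → M.El B →
    M.El (bangTensor L B)
  | [], _, _, y => M.bang y
  | _ :: L, _, xs, y => M.pair (M.bang xs.1) (tensor L xs.2 y)

theorem tensor_congr : (L : List (Formula α)) → {B : Formula α} → {xs xs' : Tuple M.El L} →
    {y y' : M.El B} → Tuple.Rel (fun _ => M.rel) xs xs' → M.rel y y' →
    M.rel (M.tensor L xs y) (M.tensor L xs' y')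
  | [], _, _, _, _, _, _, hy => M.bang_congr hy
  | _ :: L, _, _, _, _, _, hx, hy =>
    M.pair_congr (M.bang_congr hx.1) (tensor_congr L hx.2 hy)

/-- The first hypothesis is parked at the front of `Δ` while the others are treated, so the
induction needs an arbitrary tuple `zs` for `Δ`. The same device appears in `eval_ders`,
`eval_merges` and `eval_ctrs`. -/
theorem eval_tensorLs {B C : Formula α} : (L Δ : List (Formula α)) → (xs : Tuple M.El L) →
    (y : M.El B) → (zs : Tuple M.El Δ) → (π : Deriv (ILL.bangs (L ++ [B]) ++ Δ) C) →
    M.rel (M.eval (Γ := _ :: Δ) (M.tensor L xs y, zs) (tensorLs L Δ π))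
      (M.eval ((M.bangs (xs.snoc y)).append zs) π)
  | [], _, _, _, _, _ => M.rel_refl _
  | A :: L, Δ, xs, y, zs, π => by
    refine M.rel_trans (M.eval_tensorL _ _ _ _) (M.rel_trans (M.eval_exch _ _ _) ?_)
    refine M.rel_trans (eval_tensorLs L (.bang A :: Δ) xs.2 y (M.bang xs.1, zs) _) ?_
    refine M.rel_trans (M.eval_exch _ _ _) ?_
    rw [Exch.pull_back]
    exact M.rel_refl _

theorem eval_ders {B : Formula α} : (Γ Δ : List (Formula α)) → (xs : Tuple M.El Γ) →
    (zs : Tuple M.El Δ) → (π : Deriv (Γ ++ Δ) B) →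
    M.rel (M.eval ((M.bangs xs).append zs) (ders Γ Δ π)) (M.eval (xs.append zs) π)
  | [], _, _, _, _ => M.rel_refl _
  | A :: Γ, Δ, xs, zs, π => by
    refine M.rel_trans (M.eval_exch _ _ _) ?_
    refine M.rel_trans (y := M.eval ((M.bangs xs.2).append (Δ := .bang A :: Δ)
      (M.bang xs.1, zs)) (ders Γ (.bang A :: Δ) (.exch (.back _ Γ Δ) (.der π)))) ?_ ?_
    · erw [Exch.pull_front]
      exact M.rel_refl _
    refine M.rel_trans (eval_ders Γ (.bang A :: Δ) xs.2 (M.bang xs.1, zs) _) ?_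
    refine M.rel_trans (M.eval_exch _ _ _) ?_
    rw [Exch.pull_back]
    exact M.eval_der _ _ _

theorem eval_merge {A B : Formula α} {Δ : List (Formula α)} (x : M.El A) (zs : Tuple M.El Δ) :
    (n : ℕ) → (π : Deriv (List.replicate n (.bang A) ++ Δ) B) →
    M.rel (M.eval (Γ := _ :: Δ) (M.bang x, zs) (merge n π))
      (M.eval ((Tuple.replicate (M.bang x) n).append zs) π)
  | 0, _ => M.eval_wk _ _ _
  | 1, _ => M.rel_refl _
  | n + 2, π => M.rel_trans (eval_merge x zs (n + 1) (.ctr π)) (M.eval_ctr _ _ _)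

theorem pull_ofEq_replicate {A : Formula α} {Γ Δ : List (Formula α)} (x : M.El A)
    (xs : Tuple M.El Γ) (zs : Tuple M.El Δ) : (n : ℕ) →
    (h : ILL.bangs (List.replicate n A ++ Γ) ++ Δ =
      List.replicate n (.bang A) ++ (ILL.bangs Γ ++ Δ)) →
    (Exch.ofEq h).pull ((Tuple.replicate (M.bang x) n).append ((M.bangs xs).append zs)) =
      (M.bangs ((Tuple.replicate x n).append xs)).append zs
  | 0, _ => Exch.pull_refl _ _
  | n + 1, h => by
    have h' : ILL.bangs (List.replicate n A ++ Γ) ++ Δ =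
      List.replicate n (.bang A) ++ (ILL.bangs Γ ++ Δ) := by simp
    have e : Exch.ofEq h = Exch.cons (Formula.bang A) (Exch.ofEq h') :=
      Exch.ofEq_cons (Formula.bang A) h' h
    refine (congrArg (fun σ => Exch.pull (f := M.El) σ
      ((Tuple.replicate (M.bang x) (n + 1)).append ((M.bangs xs).append zs))) e).trans ?_
    exact congrArg (Prod.mk (M.bang x)) (pull_ofEq_replicate x xs zs n h')

theorem eval_merges {B : Formula α} : (Γ : List (Formula α)) → (n : Fin Γ.length → ℕ) →
    (Δ : List (Formula α)) → (xs : Tuple M.El Γ) → (zs : Tuple M.El Δ) →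
    (π : Deriv (ILL.bangs (ILL.expand Γ n) ++ Δ) B) →
    M.rel (M.eval ((M.bangs xs).append zs) (merges Γ n Δ π))
      (M.eval ((M.bangs (M.expand xs n)).append zs) π)
  | [], _, _, _, _, _ => M.rel_refl _
  | A :: Γ, n, Δ, xs, zs, π => by
    refine M.rel_trans (M.eval_exch _ _ _) ?_
    erw [Exch.pull_front]
    refine M.rel_trans (eval_merges Γ _ (.bang A :: Δ) xs.2 (M.bang xs.1, zs) _) ?_
    refine M.rel_trans (M.eval_exch _ _ _) ?_
    rw [Exch.pull_back]
    refine M.rel_trans (M.eval_merge _ _ _ _) (M.rel_trans (M.eval_exch _ _ _) ?_)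
    erw [M.pull_ofEq_replicate]
    exact M.rel_refl _

/-- Contractions and weakenings replace each `bang x` by the prescribed number of copies, and
derelictions then strip `bang` from each copy. -/
theorem eval_plainForm {Γ : List (Formula α)} {B : Formula α} (n : Fin Γ.length → ℕ)
    (xs : Tuple M.El Γ) (π : Deriv (ILL.expand Γ n) B) :
    M.rel (M.eval (M.bangs xs) (plainForm n π)) (M.eval (M.expand xs n) π) := by
  refine M.rel_trans (M.eval_exch _ _ _) ?_
  rw [Exch.pull_ofEq_append_nil]
  refine M.rel_trans (M.eval_merges _ _ _ _ _ _) (M.rel_trans (M.eval_ders _ _ _ _ _) ?_)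
  refine M.rel_trans (M.eval_exch _ _ _) ?_
  rw [Exch.pull_ofEq_append_nil_symm]
  exact M.rel_refl _

theorem eval_tensorProm {Γ : List (Formula α)} (xs : Tuple M.El Γ) : (L : List (Formula α)) →
    {B : Formula α} → (ψs : Tuple (fun C => Deriv (ILL.bangs Γ) C) L) →
    (ψ : Deriv (ILL.bangs Γ) B) →
    M.rel (M.eval (M.copies xs (L.length + 1)) (tensorProm L ψs ψ))
      (M.tensor L (ψs.map fun _ φ => M.eval (M.bangs xs) φ) (M.eval (M.bangs xs) ψ))
  | [], _, _, _ => by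
    refine M.rel_trans (M.eval_exch _ _ _) ?_
    erw [Exch.pull_ofEq_append_nil_symm]
    exact M.eval_prom xs _
  | _ :: L, _, ψs, ψ =>
    M.rel_trans (M.eval_tensorR _ _ _ _)
      (M.pair_congr (M.eval_prom _ _) (eval_tensorProm xs L ψs.2 ψ))

theorem eval_ctrs {B : Formula α} : (Γ Δ : List (Formula α)) → (xs : Tuple M.El Γ) →
    (zs : Tuple M.El Δ) → (π : Deriv (ILL.bangs Γ ++ (ILL.bangs Γ ++ Δ)) B) →
    M.rel (M.eval ((M.bangs xs).append zs) (Deriv.ctrs Γ Δ π))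
      (M.eval ((M.bangs xs).append ((M.bangs xs).append zs)) π)
  | [], _, _, _, _ => M.rel_refl _
  | A :: Γ, Δ, xs, zs, π => by
    refine M.rel_trans (M.eval_exch _ _ _) ?_
    erw [Exch.pull_front]
    refine M.rel_trans (eval_ctrs Γ (.bang A :: Δ) xs.2 (M.bang xs.1, zs) _) ?_
    refine M.rel_trans (M.eval_exch _ _ _) ?_
    simp only [Exch.pull]
    rw [Exch.pull_under, Exch.pull_back, Exch.pull_back]
    refine M.rel_trans (M.eval_ctr _ _ _) (M.rel_trans (M.eval_exch _ _ _) ?_)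
    simp only [Exch.pull]
    erw [Exch.pull_front]
    exact M.rel_refl _

theorem eval_ctrCopies {Γ : List (Formula α)} {B : Formula α} (xs : Tuple M.El Γ) : (m : ℕ) →
    (π : Deriv (ILL.copies Γ (m + 1)) B) →
    M.rel (M.eval (M.bangs xs) (ctrCopies m π)) (M.eval (M.copies xs (m + 1)) π)
  | 0, π => by
    refine M.rel_trans (M.eval_exch _ _ _) ?_
    rw [Exch.pull_ofEq_append_nil]
    exact M.rel_refl _
  | m + 1, π => M.rel_trans (eval_ctrCopies xs m _) (M.eval_ctrs _ _ _ _ _)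

/-- The proof obtained from a family of proofs by promotions, contractions and left tensor rules
acts on tensor products componentwise. -/
theorem eval_tensorLs_ctrCopies {L L' : List (Formula α)} {B B' : Formula α}
    (ψs : Tuple (fun C => Deriv (ILL.bangs (L ++ [B])) C) L') (ψ : Deriv (ILL.bangs (L ++ [B])) B')
    (xs : Tuple M.El L) (y : M.El B) :
    M.rel (M.eval (Γ := [bangTensor L B]) (M.tensor L xs y, ⟨⟩)
        (tensorLs L [] (.exch (.ofEq (List.append_nil _).symm)
          (ctrCopies L'.length (tensorProm L' ψs ψ)))))
      (M.tensor L' (ψs.map fun _ φ => M.eval (M.bangs (xs.snoc y)) φ)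
        (M.eval (M.bangs (xs.snoc y)) ψ)) := by
  refine M.rel_trans (M.eval_tensorLs L [] xs y ⟨⟩ _) (M.rel_trans (M.eval_exch _ _ _) ?_)
  rw [Exch.pull_ofEq_append_nil_symm]
  exact M.rel_trans (M.eval_ctrCopies _ _ _) (M.eval_tensorProm _ _ _ _)

end Model

/-! ### Evaluation by cuts -/

theorem Exch.act_refl {β : Type v} {γ : Type w} : (Γ : List β) → (l : List γ) →
    (Exch.refl Γ).act l = l
  | [], _ => rfl
  | _ :: _, [] => rfl
  | _ :: Γ, x :: l => congrArg (List.cons x) (act_refl Γ l)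

open Deriv

variable {α : Type v}

namespace CutEquiv

theorem of_eq {Γ : List (Formula α)} {A : Formula α} {π ρ : Deriv Γ A} (h : π = ρ) :
    CutEquiv π ρ := h ▸ .refl _

/-- With equal endpoints the transport in `Exch.ofEq` computes to the identity. When the left
contexts of cuts are empty, many reassociations are of this kind. -/
theorem exch_ofEq_self {Γ : List (Formula α)} {A : Formula α} (h : Γ = Γ) (π : Deriv Γ A) :
    CutEquiv (.exch (.ofEq h) π) π := .exch_refl π

theorem exch_trans {Γ Δ Θ : List (Formula α)} {A : Formula α} (σ : Exch Γ Δ) (τ : Exch Δ Θ)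
    (π : Deriv Γ A) : CutEquiv (.exch (.trans σ τ) π) (.exch τ (.exch σ π)) :=
  (exch_exch σ τ π).symm

theorem cutAt_nil {Δ : List (Formula α)} {A B : Formula α} (x : Deriv [] A)
    (ρ : Deriv (A :: Δ) B) : CutEquiv (cutAt (Γ := []) [] x ρ) (.cut x ρ) :=
  (exch_refl _).trans (.cut (.refl _) (.exch_refl _))

/-- Cuts of closed proofs against two different hypotheses commute; this makes evaluation by
successive cuts independent of the order of the hypotheses. -/
theorem cut_cutAt_closed {Θ : List (Formula α)} {A B C : Formula α} (x : Deriv [] A)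
    (y : Deriv [] B) (τ : Deriv (A :: B :: Θ) C) :
    CutEquiv (.cut (Γ := []) x (cutAt (Γ := []) [A] y τ)) (.cut (Γ := []) y (.cut (Γ := []) x τ)) :=
  (cut_cutAt x y τ).trans (cutAt_nil y _)

theorem cutAt_single_swap {Θ : List (Formula α)} {A P B : Formula α} (x : Deriv [] A)
    (ρ : Deriv (A :: P :: Θ) B) :
    CutEquiv (cutAt (Γ := []) [P] x (.exch (.swap A P Θ) ρ)) (.cut (Γ := []) x ρ) := by
  refine (exch_refl _).trans (.cut (.refl _) ?_)
  refine (exch_exch _ _ _).trans ((exch_same ?_ _).trans (.exch_refl _))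
  -- The composite swaps the first two positions twice. `exch_same` only asks for the action on
  -- position labels, and the label list is long enough for both swaps to be visible.
  have h : ∀ l : List ℕ, 2 ≤ l.length →
      (Exch.trans (.swap A P Θ) (.front A [P] Θ)).act l = (Exch.refl (A :: P :: Θ)).act l := by
    rintro (_ | ⟨a, _ | ⟨b, l⟩⟩) hl
    · simp at hl
    · simp at hl
    · simp [Exch.act, Exch.front, Exch.act_refl, Exch.refl]
  exact h _ (by simp)

end CutEquiv

/-- Cuts of closed proofs against all hypotheses. -/
def closeAll {B : Formula α} : {Γ : List (Formula α)} → Tuple (fun C => Deriv [] C) Γ →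
    Deriv Γ B → Deriv [] B
  | [], _, π => π
  | _ :: _, xs, π => closeAll xs.2 (.cut (Γ := []) xs.1 π)

theorem closeAll_congr {B : Formula α} : {Γ : List (Formula α)} →
    (xs : Tuple (fun C => Deriv [] C) Γ) → {π ρ : Deriv Γ B} → CutEquiv π ρ →
    CutEquiv (closeAll xs π) (closeAll xs ρ)
  | [], _, _, _, h => h
  | _ :: _, xs, _, _, h => closeAll_congr xs.2 (.cut (.refl _) h)

theorem closeAll_exch {B : Formula α} : {Γ Δ : List (Formula α)} → (σ : Exch Γ Δ) →
    (xs : Tuple (fun C => Deriv [] C) Δ) → (π : Deriv Γ B) →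
    CutEquiv (closeAll xs (.exch σ π)) (closeAll (σ.pull xs) π)
  | _, _, .nil, _, π => .exch_refl π
  | _, _, .cons _ σ, xs, π =>
    (closeAll_congr xs.2 (.cut_exch_right σ xs.1 π)).trans (closeAll_exch σ xs.2 _)
  | _, _, .swap _ _ _, xs, _ =>
    -- Interchanging the two outer cuts puts the second one in the displayed form of `cutAt`, where
    -- it absorbs the swap.
    closeAll_congr xs.2.2 (((CutEquiv.cut_cutAt_closed xs.1 xs.2.1 _).symm.trans
      (.cut (.refl _) (CutEquiv.cutAt_single_swap xs.2.1 _))))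
  | _, _, .trans σ τ, xs, π =>
    (closeAll_congr xs (CutEquiv.exch_trans σ τ π)).trans
      ((closeAll_exch τ xs _).trans (closeAll_exch σ _ π))

theorem closeAll_tensorR_nil {A B : Formula α} (π : Deriv [] A) : {Δ : List (Formula α)} →
    (ys : Tuple (fun C => Deriv [] C) Δ) → (ρ : Deriv Δ B) →
    CutEquiv (closeAll ys (.tensorR (Γ := []) π ρ)) (.tensorR (Γ := []) π (closeAll ys ρ))
  | [], _, _ => .refl _
  | _ :: _, ys, ρ =>
    (closeAll_congr ys.2 ((CutEquiv.cutAt_nil _ _).symm.trans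
      (.cut_tensorR_right (Δ := []) ys.1 π ρ))).trans (closeAll_tensorR_nil π ys.2 _)

theorem closeAll_tensorR {A B : Formula α} : {Γ Δ : List (Formula α)} →
    (xs : Tuple (fun C => Deriv [] C) Γ) → (ys : Tuple (fun C => Deriv [] C) Δ) →
    (π : Deriv Γ A) → (ρ : Deriv Δ B) →
    CutEquiv (closeAll (xs.append ys) (.tensorR π ρ))
      (.tensorR (Γ := []) (closeAll xs π) (closeAll ys ρ))
  | [], _, _, ys, π, ρ => closeAll_tensorR_nil π ys ρ
  | _ :: _, _, xs, ys, π, ρ =>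
    (closeAll_congr (xs.2.append ys) ((CutEquiv.cut_tensorR_left (Γ := []) xs.1 π ρ).trans
      (CutEquiv.exch_ofEq_self _ _))).trans (closeAll_tensorR xs.2 ys _ ρ)

/-- A cut passes inside a promotion when the proof being cut in is itself a promotion; hence the
restriction to banged tuples. -/
theorem closeAll_prom {A : Formula α} : {Γ : List (Formula α)} →
    (xs : Tuple (fun C => Deriv [] C) Γ) → (π : Deriv (bangs Γ) A) →
    CutEquiv (closeAll (xs.bangs (f := fun C => Deriv [] C) (.prom (Γ := []))) (.prom π))
      (.prom (Γ := []) (closeAll (xs.bangs (f := fun C => Deriv [] C) (.prom (Γ := []))) π))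
  | [], _, _ => .refl _
  | _ :: Γ, xs, π =>
    (closeAll_congr _ ((CutEquiv.exch_ofEq_self _ _).symm.trans
      ((CutEquiv.prom_prom (Γ := []) (Δ := Γ) xs.1 π).trans
        (.prom (CutEquiv.exch_ofEq_self _ _))))).trans (closeAll_prom xs.2 _)

/-- Closed proofs up to cut-elimination. -/
def cutModel (α : Type v) : Model.{v, v} α where
  El := fun C => Deriv [] C
  rel := CutEquiv
  rel_refl := .refl
  rel_trans := .trans
  bang := .prom (Γ := [])
  bang_congr := .prom (Γ := [])
  pair := .tensorR (Γ := [])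
  pair_congr := .tensorR (Γ := [])
  eval := closeAll
  eval_exch := closeAll_exch
  eval_tensorL x y xs π := closeAll_congr xs ((CutEquiv.exch_ofEq_self _ _).symm.trans
    ((CutEquiv.tensor_step (Γ := []) (Δ := []) x y π).trans (CutEquiv.cut_cutAt_closed x y π)))
  eval_tensorR := closeAll_tensorR
  eval_der x xs π := closeAll_congr xs (.prom_der (Γ := []) x π)
  -- A promoted closed proof has empty context, so the weakenings `wks []` and contractions `ctrs
  -- []` left by the exponential steps do nothing.
  eval_wk x xs π := closeAll_congr xs (.prom_wk (Γ := []) x π)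
  eval_ctr x xs π := closeAll_congr xs ((CutEquiv.prom_ctr (Γ := []) x π).trans
    (CutEquiv.cut_cutAt_closed _ _ _))
  eval_prom := closeAll_prom

theorem cutModel_tensor : (L : List (Formula α)) → {B : Formula α} →
    (xs : Tuple (fun C => Deriv [] C) L) → (y : Deriv [] B) →
    (cutModel α).tensor L xs y = closedTensor L xs y
  | [], _, _, _ => rfl
  | _ :: L, _, xs, y => congrArg (Deriv.tensorR (Γ := []) (Deriv.prom (Γ := []) xs.1))
      (cutModel_tensor L xs.2 y)

/-! ### Definition by cases on booleans -/

/-- The proof of `Γ ⊢ Aᵐ` with the given components. -/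
def powerR {A : Formula α} {Γ : List (Formula α)} : (m : ℕ) → [NeZero m] →
    (Fin m → Deriv Γ A) → Deriv Γ (power A m)
  | 0, h, _ => absurd rfl h.out
  | 1, _, g => g 0
  | m + 2, _, g => .withR (g 0) (powerR (m + 1) fun i => g i.succ)

/-- Cases on an `m`-boolean in the second hypothesis. -/
def caseBool {A P : Formula α} {Γ : List (Formula α)} (m : ℕ) [NeZero m]
    (g : Fin m → Deriv (P :: Γ) A) : Deriv (P :: nbool A m :: Γ) A :=
  .exch (.swap _ _ Γ) (.exch (.cons _ (.ofEq (List.append_nil (P :: Γ))))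
    (.lolliL (powerR m g) (.ax A)))

/-- Each `&` principal step discards one component, until the selected one meets an axiom. The
exchange removes the `++ []` that the cut leaves in the context. -/
theorem cut_powerR_select {A : Formula α} {Γ : List (Formula α)} : (m : ℕ) → [NeZero m] →
    (g : Fin m → Deriv Γ A) → (i : Fin m) →
    CutEquiv (.exch (.ofEq (List.append_nil Γ)) (.cut (powerR m g) (select A m i))) (g i)
  | 0, h, _, _ => absurd rfl h.out
  | 1, _, g, i => by
    obtain rfl := Subsingleton.elim i 0
    exact .cut_ax (g 0)
  | m + 2, _, g, i => by
    induction i using Fin.cases with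
    | zero => exact (CutEquiv.exch _ (.with_step₀ _ _ _)).trans (.cut_ax (g 0))
    | succ j =>
      have e : select A (m + 2) j.succ = .withL₁ A (select A (m + 1) j) := by
        obtain ⟨j, hj⟩ := j
        rfl
      rw [e]
      exact (CutEquiv.exch _ (.with_step₁ _ _ _)).trans
        (cut_powerR_select (m + 1) (fun i => g i.succ) j)

theorem cut_lolliL_ax {A B : Formula α} {Δ : List (Formula α)} (π : Deriv [A] B) (ρ : Deriv Δ A) :
    CutEquiv (.cut (Γ := []) (.lolliR π) (.lolliL (Δ := []) ρ (.ax B)))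
      (.cut (Γ := Δ) (Δ := []) ρ π) :=
  (CutEquiv.exch_refl _).symm.trans
    ((CutEquiv.lolli_step (Γ := []) (Δ := Δ) (Θ := []) π ρ (.ax B)).trans (.cut_ax _))

/-- The `⊸` principal step cuts the tuple of branches against the selection inside the numeral. This
is the `β`-rule for case distinction. -/
theorem cutAt_caseBool {A P : Formula α} {Γ : List (Formula α)} (m : ℕ) [NeZero m]
    (g : Fin m → Deriv (P :: Γ) A) (i : Fin m) :
    CutEquiv (cutAt (Γ := []) [P] (numeral A i) (caseBool m g)) (g i) := by
  refine (CutEquiv.cutAt_single_swap _ _).trans ?_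
  refine (CutEquiv.cut_exch_right _ _ _).trans ?_
  refine (CutEquiv.exch _ (cut_lolliL_ax (select A m i) (powerR m g))).trans ?_
  exact cut_powerR_select m g i

/-- Cuts of closed proofs against all hypotheses but the first. -/
def closeTail {P B : Formula α} : {Γ : List (Formula α)} → Tuple (fun C => Deriv [] C) Γ →
    Deriv (P :: Γ) B → Deriv [P] B
  | [], _, π => π
  | _ :: _, xs, π => closeTail xs.2 (cutAt (Γ := []) [P] xs.1 π)

theorem closeTail_congr {P B : Formula α} : {Γ : List (Formula α)} →
    (xs : Tuple (fun C => Deriv [] C) Γ) → {π ρ : Deriv (P :: Γ) B} → CutEquiv π ρ →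
    CutEquiv (closeTail xs π) (closeTail xs ρ)
  | [], _, _, _, h => h
  | _ :: _, xs, _, _, h =>
    closeTail_congr xs.2 (.exch (.block [] [P] _) (.cut (.refl xs.1) (.exch (.front _ [P] _) h)))

/-- A table ends with the right `⊸`-rule, so the cuts move above it and leave the abstracted
hypothesis `P` open; `closeTail` records the result. -/
theorem closeAll_lolliR {P B : Formula α} : {Γ : List (Formula α)} →
    (xs : Tuple (fun C => Deriv [] C) Γ) → (π : Deriv (P :: Γ) B) →
    CutEquiv (closeAll xs (.lolliR π)) (.lolliR (closeTail xs π))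
  | [], _, _ => .refl _
  | _ :: _, xs, π =>
    (closeAll_congr xs.2 (.cut_lolliR (Γ := []) xs.1 π)).trans (closeAll_lolliR xs.2 _)

/-- The multiplicities `t₀, …, tₕ₋₁, a, b`. -/
def counts {β : Type v} (S N H : β) : (h : ℕ) → (Fin h → ℕ) → ℕ → ℕ →
    Fin ((List.replicate h S ++ [N]) ++ [H]).length → ℕ
  | 0, _, a, b => Fin.cons (α := fun _ => ℕ) a fun _ => b
  | h + 1, t, a, b => Fin.cons (α := fun _ => ℕ) (t 0) (counts S N H h (fun i => t i.succ) a b)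

/-- Cases on `c` hypotheses that are `m`-booleans. -/
def casesReplicate {A P : Formula α} {Γ : List (Formula α)} (m : ℕ) [NeZero m] : (c : ℕ) →
    ((Fin c → Fin m) → Deriv (P :: Γ) A) → Deriv (P :: (List.replicate c (nbool A m) ++ Γ)) A
  | 0, g => g Fin.elim0
  | c + 1, g => caseBool m fun i =>
      casesReplicate m c fun v => g (Fin.cons (α := fun _ => Fin m) i v)

section Tape

variable {A P : Formula α} (s n l : ℕ) [NeZero s] [NeZero n] [NeZero l] (a b : ℕ)

/-- Cases on `tⱼ` copies of the `j`-th tape square, `a` copies of the state and `b` copies of the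
head position. -/
def casesTape : (h : ℕ) → (t : Fin h → ℕ) →
    ((∀ j, Fin (t j) → Fin s) → (Fin a → Fin n) → (Fin b → Fin l) → Deriv [P] A) →
    Deriv (P :: expand ((List.replicate h (nbool A s) ++ [nbool A n]) ++ [nbool A l])
      (counts (nbool A s) (nbool A n) (nbool A l) h t a b)) A
  | 0, _, g => casesReplicate (Γ := List.replicate b (nbool A l) ++ []) n a fun x =>
      casesReplicate (Γ := []) l b fun y => g (fun j => j.elim0) x y
  | h + 1, t, g => casesReplicate s (t 0) fun u =>
      casesTape h (fun i => t i.succ) fun us => g (Fin.cons (α := fun j => Fin (t j) → Fin s) u us)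

/-- The proof that maps booleans to the boolean given by a function of their values. -/
def table (h : ℕ) (t : Fin h → ℕ) {p : ℕ}
    (f : (∀ j, Fin (t j) → Fin s) → (Fin a → Fin n) → (Fin b → Fin l) → Fin p) :
    Deriv (expand ((List.replicate h (nbool A s) ++ [nbool A n]) ++ [nbool A l])
      (counts (nbool A s) (nbool A n) (nbool A l) h t a b)) (nbool A p) :=
  .lolliR (casesTape s n l a b h t fun us x y => select A p (f us x y))

/-- All copies carry the same numeral, so only the branch of the constant function survives. -/
theorem closeTail_casesReplicate {Γ : List (Formula α)} (m : ℕ) [NeZero m] (i : Fin m)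
    (xs : Tuple (fun C => Deriv [] C) Γ) : (c : ℕ) → (g : (Fin c → Fin m) → Deriv (P :: Γ) A) →
    CutEquiv (closeTail ((Tuple.replicate (f := fun C => Deriv [] C) (numeral A i) c).append xs)
      (casesReplicate m c g)) (closeTail xs (g fun _ => i))
  | 0, g => CutEquiv.of_eq (congrArg (fun v => closeTail xs (g v)) (Subsingleton.elim _ _))
  | c + 1, g => by
    refine (closeTail_congr _ (cutAt_caseBool m _ i)).trans
      ((closeTail_casesReplicate m i xs c _).trans ?_)
    refine CutEquiv.of_eq (congrArg (fun v => closeTail xs (g v)) ?_)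
    funext j
    induction j using Fin.cases <;> rfl

theorem closeTail_casesTape (q : Fin n) (p : Fin l) : (h : ℕ) → (t : Fin h → ℕ) →
    (x : Fin h → Fin s) →
    (g : (∀ j, Fin (t j) → Fin s) → (Fin a → Fin n) → (Fin b → Fin l) → Deriv [P] A) →
    CutEquiv (closeTail ((cutModel α).expand (Tuple.snoc (tapeTuple (f := (cutModel α).El) h
      (fun m => numeral A (x m)) (numeral A q)) (numeral A p)) _) (casesTape s n l a b h t g))
      (g (fun j _ => x j) (fun _ => q) (fun _ => p))
  | 0, t, x, g => by
    refine (closeTail_casesReplicate n q _ a _).trans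
      ((closeTail_casesReplicate (Γ := []) l p ⟨⟩ b _).trans ?_)
    exact CutEquiv.of_eq (congrArg (fun v => g v _ _) (Subsingleton.elim _ _))
  | h + 1, t, x, g => by
    refine (closeTail_casesReplicate s (x 0) _ (t 0) _).trans
      ((closeTail_casesTape q p h (fun i => t i.succ) (fun i => x i.succ) _).trans ?_)
    refine CutEquiv.of_eq (congrArg (fun v => g v _ _) ?_)
    funext j
    induction j using Fin.cases <;> rfl

theorem eval_table (q : Fin n) (p : Fin l) (h : ℕ) (t : Fin h → ℕ) (x : Fin h → Fin s) {r : ℕ}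
    (f : (∀ j, Fin (t j) → Fin s) → (Fin a → Fin n) → (Fin b → Fin l) → Fin r) :
    CutEquiv ((cutModel α).eval ((cutModel α).expand (Tuple.snoc (tapeTuple (f := (cutModel α).El) h
      (fun m => numeral A (x m)) (numeral A q)) (numeral A p)) _) (table s n l a b h t f))
      (numeral A (f (fun j _ => x j) (fun _ => q) (fun _ => p))) :=
  (closeAll_lolliR _ _).trans (.lolliR (closeTail_casesTape s n l a b q p h t x _))

end Tape

/-! ### One step of a Turing machine -/

section Step

variable (A : Formula α) {s n h : ℕ} [NeZero s] [NeZero n] [NeZero h]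
  (δ : Fin s × Fin n → Fin s × Fin n × Dir)

/-- The new symbol in position `m`. -/
def symbolRule (m : Fin h) (us : ∀ j, Fin (if j = m then 1 else 0) → Fin s) (x : Fin 1 → Fin n)
    (y : Fin 1 → Fin h) : Fin s :=
  -- The index `⟨0, _⟩` names the single copy of square `m`; the other squares have multiplicity
  -- zero.
  if y 0 = m then (δ (us m ⟨0, by simp⟩, x 0)).1 else us m ⟨0, by simp⟩

/-- The new state. -/
def stateRule (us : ∀ _ : Fin h, Fin 1 → Fin s) (x : Fin 1 → Fin n) (y : Fin 1 → Fin h) : Fin n :=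
  (δ (us (y 0) 0, x 0)).2.1

/-- The new head position. -/
def headRule (us : ∀ _ : Fin h, Fin 1 → Fin s) (x : Fin 1 → Fin n) (y : Fin 2 → Fin h) : Fin h :=
  -- Copy `0` of the head position is the one moved, copy `1` selects the square that is read.
  (δ (us (y 1) 0, x 0)).2.2.move (y 0)

/-- The proof computing the new symbol in position `m`. -/
def symbolProof (m : Fin h) : Deriv (bangs (tapeState A s n h ++ [nbool A h])) (nbool A s) :=
  plainForm _ (table s n h 1 1 h _ (symbolRule δ m))

/-- The proof computing the new state. -/
def stateProof : Deriv (bangs (tapeState A s n h ++ [nbool A h])) (nbool A n) :=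
  plainForm _ (table s n h 1 1 h _ (stateRule δ))

/-- The proof computing the new head position. -/
def headProof : Deriv (bangs (tapeState A s n h ++ [nbool A h])) (nbool A h) :=
  plainForm _ (table s n h 1 2 h _ (headRule δ))

/-- The proof encoding one step of the machine. -/
def absstep : Deriv [absConfig A s n h] (absConfig A s n h) :=
  tensorLs (tapeState A s n h) [] (.exch (.ofEq (List.append_nil _).symm)
    (ctrCopies (tapeState A s n h).length (tensorProm (tapeState A s n h)
      (tapeTuple (f := fun C => Deriv (bangs (tapeState A s n h ++ [nbool A h])) C) h
        (symbolProof A δ) (stateProof A δ)) (headProof A δ))))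

theorem forgetPlain_tapeTuple {Γ : List (Formula α)} {S N : Formula α} : (h : ℕ) →
    (x : Fin h → {φ : Deriv (bangs Γ) S // IsPlain φ}) → (y : {φ : Deriv (bangs Γ) N // IsPlain φ}) →
    forgetPlain _ (tapeTuple (f := fun C => {φ : Deriv (bangs Γ) C // IsPlain φ}) h x y) =
      tapeTuple (f := fun C => Deriv (bangs Γ) C) h (fun m => (x m).1) y.1
  | 0, _, _ => rfl
  | h + 1, _, y => congrArg (Prod.mk _) (forgetPlain_tapeTuple h _ y)

theorem absstep_isComponentwisePlain :
    IsComponentwisePlainTensor (L := tapeState A s n h) (B := nbool A h)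
      (L' := tapeState A s n h) (B' := nbool A h) (absstep (h := h) A δ) := by
  refine ⟨_, ⟨tapeTuple h (fun m => ⟨symbolProof A δ m, _, _, .refl _⟩)
    ⟨stateProof A δ, _, _, .refl _⟩, headProof A δ, ⟨_, _, .refl _⟩, .refl _⟩, ?_⟩
  rw [forgetPlain_tapeTuple]
  exact .refl _

/-- Common reduction for the computational and the semantic claim: only the three kinds of tables
remain to be evaluated, at copies of the arguments without `bang`. -/
theorem eval_absstep {M : Model.{v, w} α} {x θ : Fin h → M.El (nbool A s)}
    {q μ : M.El (nbool A n)} {p ν : M.El (nbool A h)}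
    (hθ : ∀ m, M.rel (M.eval (M.expand (Tuple.snoc (tapeTuple h x q) p) _)
      (table s n h 1 1 h _ (symbolRule δ m))) (θ m))
    (hμ : M.rel (M.eval (M.expand (Tuple.snoc (tapeTuple h x q) p) _)
      (table s n h 1 1 h _ (stateRule δ))) μ)
    (hν : M.rel (M.eval (M.expand (Tuple.snoc (tapeTuple h x q) p) _)
      (table s n h 1 2 h _ (headRule δ))) ν) :
    M.rel (M.eval (Γ := [absConfig A s n h]) (M.tensor (tapeState A s n h) (tapeTuple h x q) p, ⟨⟩)
      (absstep A δ)) (M.tensor (tapeState A s n h) (tapeTuple h θ μ) ν) := by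
  refine M.rel_trans (M.eval_tensorLs_ctrCopies _ _ _ _) (M.tensor_congr _ ?_ ?_)
  · rw [Tuple.map_tapeTuple]
    exact Tuple.Rel.tapeTuple h (fun m => M.rel_trans (M.eval_plainForm _ _ _) (hθ m))
      (M.rel_trans (M.eval_plainForm _ _ _) hμ)
  · exact M.rel_trans (M.eval_plainForm _ _ _) hν

theorem cut_absstep (C : Config s n h) :
    CutEquiv (Deriv.cut (Δ := []) (C.proof A) (absstep A δ)) ((C.step δ).proof A) := by
  have e (C : Config s n h) : (cutModel α).tensor (tapeState A s n h)
      (tapeTuple (f := (cutModel α).El) h (fun m => numeral A (C.tape m)) (numeral A C.state))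
      (numeral A C.head) = C.proof A := cutModel_tensor _ _ _
  have := eval_absstep (M := cutModel α) A δ (x := fun m => numeral A (C.tape m))
    (q := numeral A C.state) (p := numeral A C.head)
    (θ := fun m => numeral A ((C.step δ).tape m)) (μ := numeral A (C.step δ).state)
    (ν := numeral A (C.step δ).head) (fun m => ?_)
    (eval_table s n h 1 1 C.state C.head h _ C.tape (stateRule δ))
    (eval_table s n h 1 2 C.state C.head h _ C.tape (headRule δ))
  · rw [e C, e (C.step δ)] at this
    -- Evaluation in `cutModel` at a single argument is one cut, so the two statements agree
    -- definitionally.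
    exact this
  · refine (eval_table s n h 1 1 C.state C.head h _ C.tape (symbolRule δ m)).trans
      (CutEquiv.of_eq (congrArg _ ?_))
    -- The test in `symbolRule` corresponds to the case distinction in `Function.update`.
    by_cases hm : C.head = m
    · subst hm
      simp [symbolRule, Config.step]
    · simp [symbolRule, Config.step, hm, Ne.symm hm]

end Step

end ILL

/-! ### Group-like elements of the cofree coalgebra. -/

namespace Sweedler

open scoped TensorProduct

universe u

variable {k : Type u} [Field k] {V : Type u} [AddCommGroup V] [Module k V]

/-- The coalgebra morphism from `k` attached to a group-like element. -/
noncomputable def ofGroupLike {C : Type u} [AddCommGroup C] [Module k C] [Coalgebra k C] {g : C}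
    (hg : IsGroupLikeElem k g) : k →ₗc[k] C where
  toLinearMap := LinearMap.toSpanSingleton k C g
  counit_comp := by
    ext
    simp [hg.counit_eq_one]
  map_comp_comul := by
    ext
    simp [hg.comul_eq_tmul_self]

theorem _root_.IsGroupLikeElem.tensor {C D : Type u} [AddCommGroup C] [Module k C]
    [Coalgebra k C] [AddCommGroup D] [Module k D] [Coalgebra k D] {x : C} {y : D}
    (hx : IsGroupLikeElem k x) (hy : IsGroupLikeElem k y) : IsGroupLikeElem k (x ⊗ₜ[k] y) where
  counit_eq_one := by simp [hx.counit_eq_one, hy.counit_eq_one]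
  comul_eq_tmul_self := by
    simp [TensorProduct.comul_tmul, hx.comul_eq_tmul_self, hy.comul_eq_tmul_self]

/-- A group-like element is the image of `1` under a coalgebra morphism from `k`, and the universal
property allows only one such morphism over a given linear map `k → V`. -/
theorem Bang.eq_vac {g : Bang k V} (hg : IsGroupLikeElem k g) : g = Bang.vac (Bang.der k V g) := by
  have h := (Bang.existsUnique_lift (C := k)
    (LinearMap.toSpanSingleton k V (Bang.der k V g))).unique
    (y₁ := ofGroupLike hg) (y₂ := Bang.lift (LinearMap.toSpanSingleton k V (Bang.der k V g)))
    (by ext; simp [ofGroupLike]) (Bang.der_comp_lift _)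
  have h1 := congrArg (fun f => f (1 : k)) h
  exact (one_smul k g).symm.trans h1

/-- Coalgebra morphisms preserve group-like elements, and the image lies over `f g`. This is the
semantics of promotion at vacuum vectors. -/
theorem Bang.lift_groupLike {C : Type u} [AddCommGroup C] [Module k C] [Coalgebra k C]
    [Coalgebra.IsCocomm k C] (f : C →ₗ[k] V) {g : C} (hg : IsGroupLikeElem k g) :
    Bang.lift f g = Bang.vac (f g) := by
  rw [Bang.eq_vac (hg.map (Bang.lift f))]
  exact congrArg Bang.vac (congrArg (fun F => F g) (Bang.der_comp_lift f))

end Sweedler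

/-! ### Evaluation of proofs at vectors. -/

namespace ILL

open scoped TensorProduct

universe u v w

open Deriv Sweedler

variable {α : Type v} (k : Type u) [Field k] (v : α → ModuleCat.{u} k)

/-- The pure tensor of a tuple of vectors. -/
noncomputable def tmulAll : {Γ : List (Formula α)} → Tuple (fun C => den k v C) Γ → denCtx k v Γ
  | [], _ => (1 : k)
  | A :: Γ, xs => (xs.1 ⊗ₜ[k] tmulAll xs.2 : den k v A ⊗[k] denCtx k v Γ)

theorem denExch_tmulAll : {Γ Δ : List (Formula α)} → (σ : Exch Γ Δ) →
    (xs : Tuple (fun C => den k v C) Δ) →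
    denExch k v σ (tmulAll k v (σ.pull xs)) = tmulAll k v xs
  | _, _, .nil, _ => rfl
  | _, _, .cons A σ, xs => by
    refine (TensorProduct.congr_tmul (R := k) _ _ _ _).trans ?_
    exact congrArg (fun y => xs.1 ⊗ₜ[k] y) (denExch_tmulAll σ xs.2)
  | _, _, .swap _ _ _, xs => rfl
  | _, _, .trans σ τ, xs =>
    (congrArg (denExch k v τ) (denExch_tmulAll σ _)).trans (denExch_tmulAll τ xs)

theorem denExch_symm_tmulAll {Γ Δ : List (Formula α)} (σ : Exch Γ Δ)
    (xs : Tuple (fun C => den k v C) Δ) :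
    (denExch k v σ).symm (tmulAll k v xs) = tmulAll k v (σ.pull xs) := by
  rw [← denExch_tmulAll k v σ xs, LinearEquiv.symm_apply_apply]

theorem split_tmulAll : {Γ Δ : List (Formula α)} → (xs : Tuple (fun C => den k v C) Γ) →
    (ys : Tuple (fun C => den k v C) Δ) →
    split k v Γ Δ (tmulAll k v (xs.append ys)) = tmulAll k v xs ⊗ₜ[k] tmulAll k v ys
  | [], _, _, _ => rfl
  | A :: Γ, Δ, xs, ys => by
    have h := split_tmulAll xs.2 ys
    change (TensorProduct.assoc k (den k v A) (denCtx k v Γ) (denCtx k v Δ)).symm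
      (xs.1 ⊗ₜ[k] split k v Γ Δ (tmulAll k v (Tuple.append xs.2 ys))) = _
    rw [h]
    rfl

/-- A tensor product of group-like elements is group-like for the tensor product coalgebra, so
`Bang.lift_groupLike` applies to promotions in several hypotheses. -/
theorem isGroupLikeElem_tmulAll : {Γ : List (Formula α)} → (xs : Tuple (fun C => den k v C) Γ) →
    letI := ctxCoalgebra k v Γ
    IsGroupLikeElem k (tmulAll k v (xs.bangs (f := fun C => den k v C)
      fun {A} x => Bang.vac (k := k) (V := den k v A) x))
  | [], _ => isGroupLikeElem_self.2 rfl
  | A :: Γ, xs => by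
    let := ctxCoalgebra k v Γ
    have h := isGroupLikeElem_tmulAll xs.2
    have h' := Bang.vac_isGroupLike (k := k) (V := den k v A) xs.1
    exact h'.tensor h

/-- Vectors. -/
noncomputable def denModel : Model.{v, u} α where
  El := fun C => den k v C
  rel := Eq
  rel_refl _ := rfl
  rel_trans := Eq.trans
  bang {A} x := Bang.vac (k := k) (V := den k v A) x
  bang_congr h := congrArg _ h
  pair {A B} x y := (x ⊗ₜ[k] y : den k v A ⊗[k] den k v B)
  pair_congr h h' := congrArg₂ _ h h'
  eval xs π := denote k v π (tmulAll k v xs)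
  eval_exch σ xs π := congrArg (denote k v π) (denExch_symm_tmulAll k v σ xs)
  eval_tensorL _ _ _ _ := rfl
  eval_tensorR xs ys π ρ := congrArg (TensorProduct.map (denote k v π) (denote k v ρ))
    (split_tmulAll k v xs ys)
  eval_der x xs π := congrArg (fun y => denote k v π (y ⊗ₜ[k] tmulAll k v xs)) (Bang.der_vac x)
  eval_wk x xs π := by
    have h := (Bang.vac_isGroupLike (k := k) x).counit_eq_one
    exact congrArg (denote k v π) ((congrArg (fun c : k => c • tmulAll k v xs) h).trans
      (one_smul k _))
  eval_ctr {Γ A B} x xs π := by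
    have h := (Bang.vac_isGroupLike (k := k) x).comul_eq_tmul_self
    exact congrArg (fun y => denote k v π (TensorProduct.assoc k (Bang k (den k v A))
      (Bang k (den k v A)) (denCtx k v Γ) (y ⊗ₜ[k] tmulAll k v xs))) h
  eval_prom {Γ A} xs π := by
    let := ctxCoalgebra k v Γ
    have := ctxCocomm k v Γ
    exact Bang.lift_groupLike (denote k v π) (isGroupLikeElem_tmulAll k v xs)

theorem denModel_tensor : (L : List (Formula α)) → {B : Formula α} →
    (xs : Tuple (fun C => den k v C) L) → (y : den k v B) →
    (denModel k v).tensor L xs y = vacTensor k v L xs y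
  | [], _, _, _ => rfl
  | A :: L, B, xs, y => congrArg (fun z => (Bang.vac (k := k) (V := den k v A) xs.1 ⊗ₜ[k] z :
      Bang k (den k v A) ⊗[k] den k v (bangTensor L B))) (denModel_tensor L xs.2 y)

/-- Evaluation of linear maps at a vector. -/
noncomputable def applyAt {A B : Formula α} (y : den k v A) :
    den k v (.lolli A B) →ₗ[k] den k v B :=
  (LinearMap.applyₗ y : (den k v A →ₗ[k] den k v B) →ₗ[k] den k v B)

theorem lolli_ext {A B : Formula α} {f g : den k v (.lolli A B)}
    (h : ∀ z, applyAt k v z f = applyAt k v z g) : f = g := LinearMap.ext h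

/-- The numeral `i` denotes the `i`-th projection. The factors `1` removed by `one_smul` come from
the empty context. -/
theorem denote_select_powerR {A : Formula α} {Γ : List (Formula α)} (x : denCtx k v Γ) :
    (m : ℕ) → [NeZero m] → (g : Fin m → Deriv Γ A) → (i : Fin m) →
    applyAt k v (denote k v (powerR m g) x) (num k v A i) = denote k v (g i) x
  | 0, h, _, _ => absurd rfl h.out
  | 1, _, g, i => by
    obtain rfl := Subsingleton.elim i 0
    exact one_smul k _
  | m + 2, _, g, i => by
    induction i using Fin.cases with
    | zero => exact one_smul k _
    | succ j => exact denote_select_powerR x (m + 1) (fun i => g i.succ) j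

theorem denote_caseBool {A P : Formula α} {Γ : List (Formula α)} (m : ℕ) [NeZero m]
    (g : Fin m → Deriv (P :: Γ) A) (z : den k v P) (f : den k v (nbool A m))
    (xs : Tuple (fun C => den k v C) Γ) :
    denote k v (caseBool m g) (tmulAll k v (Γ := P :: nbool A m :: Γ) (z, f, xs)) =
      applyAt k v (denote k v (powerR m g) (tmulAll k v (Γ := P :: Γ) (z, xs))) f := by
  let zs : Tuple (fun C => den k v C) (P :: Γ) := (z, xs)
  refine ((denModel k v).eval_exch _ _ _).trans (((denModel k v).eval_exch _
    (show Tuple (fun C => den k v C) (nbool A m :: P :: Γ) from (f, z, xs)) _).trans ?_)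
  -- The left `⊸`-rule splits its context into `P :: Γ` and the empty context of the axiom, so the
  -- tuple is first rewritten in that form.
  have h : (Exch.ofEq (List.append_nil (P :: Γ))).pull zs = zs.append (Δ := []) ⟨⟩ :=
    Exch.pull_ofEq_append_nil _ _
  have h' := split_tmulAll k v zs (Δ := []) ⟨⟩
  change TensorProduct.rid k (den k v A) (LinearMap.rTensor k _ ((TensorProduct.assoc k
    (den k v (power A m) →ₗ[k] den k v A) (denCtx k v (P :: Γ)) k).symm
      (f ⊗ₜ[k] split k v (P :: Γ) [] (tmulAll k v
        ((Exch.ofEq (List.append_nil (P :: Γ))).pull zs))))) = _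
  rw [h, h']
  exact one_smul k _

/-- A case distinction is linear in the boolean, so a linear combination of numerals yields the
corresponding combination of the branches. -/
theorem denote_caseBool_comb {A P : Formula α} {Γ : List (Formula α)} (m : ℕ) [NeZero m]
    (g : Fin m → Deriv (P :: Γ) A) (z : den k v P) (a : Fin m → k)
    (xs : Tuple (fun C => den k v C) Γ) :
    denote k v (caseBool m g) (tmulAll k v (Γ := P :: nbool A m :: Γ) (z, comb k v A a, xs)) =
      ∑ i, a i • denote k v (g i) (tmulAll k v (Γ := P :: Γ) (z, xs)) := by
  refine (denote_caseBool k v m g z _ xs).trans ((map_sum (applyAt k v _) _ _).trans ?_)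
  exact Finset.sum_congr rfl fun i _ => (map_smul (applyAt k v _) _ _).trans
    (congrArg (a i • ·) (denote_select_powerR k v _ m g i))

theorem sum_fin_cons {M : Type*} [AddCommMonoid M] {n : ℕ} {X : Fin (n + 1) → Type*}
    [∀ i, Fintype (X i)] (F : (∀ i, X i) → M) :
    ∑ u, F u = ∑ i : X 0, ∑ u : ∀ j : Fin n, X j.succ, F (Fin.cons i u) := by
  rw [← (Fin.consEquiv X).sum_comp, Fintype.sum_prod_type]
  rfl

/-- Each copy is expanded separately, so all words `u` occur and not merely the constant ones as for
numerals. -/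
theorem denote_casesReplicate {A P : Formula α} {Γ : List (Formula α)} (m : ℕ) [NeZero m]
    (a : Fin m → k) (z : den k v P) (xs : Tuple (fun C => den k v C) Γ) : (c : ℕ) →
    (g : (Fin c → Fin m) → Deriv (P :: Γ) A) →
    denote k v (casesReplicate m c g) (tmulAll k v (Γ := P :: _)
      (z, (Tuple.replicate (f := fun C => den k v C) (comb k v A a) c).append xs)) =
      ∑ u : Fin c → Fin m, (∏ j, a (u j)) • denote k v (g u) (tmulAll k v (Γ := P :: Γ) (z, xs))
  | 0, g => by
    rw [Fintype.sum_unique, Finset.univ_eq_empty, Finset.prod_empty, one_smul]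
    exact congrArg (fun u => denote k v (g u) (tmulAll k v (Γ := P :: Γ) (z, xs)))
      (Subsingleton.elim _ _)
  | c + 1, g => by
    rw [sum_fin_cons]
    refine (denote_caseBool_comb k v m _ z a _).trans (Finset.sum_congr rfl fun i _ => ?_)
    refine (congrArg (a i • ·) (denote_casesReplicate m a z xs c _)).trans ?_
    rw [Finset.smul_sum]
    refine Finset.sum_congr rfl fun u _ => ?_
    rw [smul_smul, Fin.prod_univ_succ, Fin.cons_zero]
    simp only [Fin.cons_succ]

/-! ### Tables at linear combinations of booleans. -/

section Tape

variable {A P : Formula α} (s n l : ℕ) [NeZero s] [NeZero n] [NeZero l] (a b : ℕ)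

/-- The linear combinations of booleans with the given coefficients. -/
noncomputable abbrev combTuple (A : Formula α) {s n l : ℕ} (h : ℕ) (x : Fin h → Fin s → k)
    (β : Fin n → k) (γ : Fin l → k) : Tuple (fun C => den k v C)
      ((List.replicate h (nbool A s) ++ [nbool A n]) ++ [nbool A l]) :=
  Tuple.snoc (tapeTuple (f := fun C => den k v C) h (fun m => comb k v A (x m)) (comb k v A β))
    (comb k v A γ)

theorem denote_casesTape (β : Fin n → k) (γ : Fin l → k) (z : den k v P) : (h : ℕ) →
    (t : Fin h → ℕ) → (x : Fin h → Fin s → k) →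
    (g : (∀ j, Fin (t j) → Fin s) → (Fin a → Fin n) → (Fin b → Fin l) → Deriv [P] A) →
    denote k v (casesTape s n l a b h t g) (tmulAll k v (Γ := P :: _) (z, (denModel k v).expand
      (combTuple k v A h x β γ) _)) =
      ∑ us : ∀ j, Fin (t j) → Fin s, ∑ q : Fin a → Fin n, ∑ p : Fin b → Fin l,
        ((∏ j, ∏ i, x j (us j i)) * (∏ i, β (q i)) * ∏ i, γ (p i)) •
          denote k v (g us q p) (tmulAll k v (Γ := [P]) (z, ⟨⟩))
  | 0, t, x, g => by
    rw [Fintype.sum_unique]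
    refine (denote_casesReplicate k v n β z _ a _).trans (Finset.sum_congr rfl fun q _ => ?_)
    refine (congrArg _ (denote_casesReplicate k v (Γ := []) l γ z ⟨⟩ b _)).trans ?_
    rw [Finset.smul_sum]
    refine Finset.sum_congr rfl fun p _ => ?_
    rw [smul_smul, Fin.prod_univ_zero, one_mul]
    exact congrArg (fun us => ((∏ i, β (q i)) * ∏ i, γ (p i)) •
      denote k v (g us q p) (tmulAll k v (Γ := [P]) (z, ⟨⟩))) (Subsingleton.elim _ _)
  | h + 1, t, x, g => by
    rw [sum_fin_cons]
    refine (denote_casesReplicate k v s (x 0) z _ (t 0) _).trans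
      (Finset.sum_congr rfl fun u _ => ?_)
    refine (congrArg _ (denote_casesTape β γ z h (fun i => t i.succ)
      (fun i => x i.succ) _)).trans ?_
    simp only [Finset.smul_sum, smul_smul]
    refine Finset.sum_congr rfl fun us _ => Finset.sum_congr rfl fun q _ =>
      Finset.sum_congr rfl fun p _ => ?_
    rw [Fin.prod_univ_succ]
    simp only [Fin.cons_zero, Fin.cons_succ, mul_assoc]

theorem denote_table (β : Fin n → k) (γ : Fin l → k) (h : ℕ) (t : Fin h → ℕ)
    (x : Fin h → Fin s → k) {r : ℕ}
    (f : (∀ j, Fin (t j) → Fin s) → (Fin a → Fin n) → (Fin b → Fin l) → Fin r) :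
    denote k v (table s n l a b h t f)
        (tmulAll k v ((denModel k v).expand (combTuple k v A h x β γ) _)) =
      ∑ us : ∀ j, Fin (t j) → Fin s, ∑ q : Fin a → Fin n, ∑ p : Fin b → Fin l,
        ((∏ j, ∏ i, x j (us j i)) * (∏ i, β (q i)) * ∏ i, γ (p i)) •
          num k v A (f us q p) := by
  -- Both sides are linear maps on a power of `A`; applying them to `z` undoes the final right
  -- `⊸`-rule of the table.
  refine lolli_ext k v fun z => ?_
  refine (denote_casesTape k v s n l a b β γ z h t x _).trans (Eq.symm ?_)
  refine (map_sum (applyAt k v z) _ _).trans (Finset.sum_congr rfl fun us _ => ?_)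
  refine (map_sum (applyAt k v z) _ _).trans (Finset.sum_congr rfl fun q _ => ?_)
  refine (map_sum (applyAt k v z) _ _).trans (Finset.sum_congr rfl fun p _ => ?_)
  exact map_smul (applyAt k v z) _ _

end Tape

/-! ### The vectors computed by one step. -/

section Step

variable {s n h : ℕ} [NeZero s] [NeZero n] [NeZero h]
  (δ : Fin s × Fin n → Fin s × Fin n × Dir)
  (a : Fin h → Fin s → k) (b : Fin n → k) (c : Fin h → k)

theorem sum_funUnique {M X : Type*} [AddCommMonoid M] [Fintype X] (F : (Fin 1 → X) → M) :
    ∑ u, F u = ∑ i, F fun _ => i :=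
  ((Equiv.funUnique (Fin 1) X).symm.sum_comp F).symm

theorem sum_finTwo {M X : Type*} [AddCommMonoid M] [Fintype X] (F : (Fin 2 → X) → M) :
    ∑ u, F u = ∑ i, ∑ j, F ![i, j] := by
  rw [← (finTwoArrowEquiv X).symm.sum_comp, Fintype.sum_prod_type]
  rfl

theorem sum_pi_fin_one {M X Y : Type*} [AddCommMonoid M] [Fintype X] [DecidableEq X] [Fintype Y]
    (F : (X → Fin 1 → Y) → M) : ∑ u, F u = ∑ i : X → Y, F fun j _ => i j :=
  ((Equiv.piCongrRight fun _ : X => Equiv.funUnique (Fin 1) Y).symm.sum_comp F).symm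

theorem denote_symbol (A : Formula α) (m : Fin h) :
    denote k v (table s n h 1 1 h _ (symbolRule δ m))
        (tmulAll k v ((denModel k v).expand (combTuple k v A h a b c) _)) =
      symbolVec k v A δ a b c m := by
  rw [denote_table, symbolVec]
  -- With one copy of square `m` and none of the others, an assignment of values amounts to one
  -- symbol.
  let e : (∀ j : Fin h, Fin (if j = m then 1 else 0) → Fin s) ≃ Fin s :=
    { toFun := fun us => us m ⟨0, by simp⟩
      invFun := fun i _ _ => i
      left_inv := fun us => by
        funext j r
        by_cases hj : j = m
        · subst hj
          exact congrArg (us j) (Fin.ext (Nat.lt_one_iff.1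
            (lt_of_lt_of_eq r.2 (if_pos rfl))).symm)
        · exact absurd (lt_of_lt_of_eq r.2 (if_neg hj)) (Nat.not_lt_zero _)
      right_inv := fun i => rfl }
  rw [← e.symm.sum_comp]
  refine Finset.sum_congr rfl fun i _ => ?_
  rw [sum_funUnique]
  refine Finset.sum_congr rfl fun q _ => ?_
  -- The head position `m` is split off: there the symbol is rewritten, elsewhere it is kept.
  rw [sum_funUnique, ← Finset.add_sum_erase _ _ (Finset.mem_univ m), smul_add, Finset.smul_sum]
  -- Weakened squares contribute empty products.
  have hp : ∏ j, ∏ r : Fin (if j = m then 1 else 0), a j (e.symm i j r) = a m i := by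
    rw [Finset.prod_eq_single m]
    · simp [e]
    · intro j _ hj
      simp [e, hj]
    · simp
  have hs : ∀ l, symbolRule δ m (e.symm i) (fun _ => q) (fun _ => l) =
      if l = m then (δ (i, q)).1 else i := fun l => rfl
  simp only [hp, hs]
  congr 1
  · simp [smul_smul]
  · refine Finset.sum_congr rfl fun l hl => ?_
    rw [if_neg (Finset.ne_of_mem_erase hl)]
    simp [smul_smul]

theorem denote_state (A : Formula α) :
    denote k v (table s n h 1 1 h _ (stateRule δ))
        (tmulAll k v ((denModel k v).expand (combTuple k v A h a b c) _)) =
      stateVec k v A δ a b c := by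
  rw [denote_table, stateVec, sum_pi_fin_one]
  simp only [sum_funUnique, Finset.univ_unique, Finset.prod_singleton]
  rfl

theorem denote_head (A : Formula α) :
    denote k v (table s n h 1 2 h _ (headRule δ))
        (tmulAll k v ((denModel k v).expand (combTuple k v A h a b c) _)) =
      headVec k v A δ a b c := by
  rw [denote_table, headVec, sum_pi_fin_one]
  -- The two copies of the head position become the separate summation indices `p` and `l`.
  simp only [sum_funUnique, sum_finTwo, Finset.univ_unique, Finset.prod_singleton,
    Fin.prod_univ_two, ← mul_assoc]
  rfl

theorem denoteMap_absstep (A : Formula α) :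
    denoteMap k v (absstep A δ) (vacTensor k v (tapeState A s n h)
      (tapeTuple h (fun m => comb k v A (a m)) (comb k v A b)) (comb k v A c)) =
    vacTensor k v (tapeState A s n h)
      (tapeTuple h (fun m => symbolVec k v A δ a b c m) (stateVec k v A δ a b c))
      (headVec k v A δ a b c) := by
  have := eval_absstep (M := denModel k v) A δ (denote_symbol k v δ a b c A)
    (denote_state k v δ a b c A) (denote_head k v δ a b c A)
  have e := fun x q p => denModel_tensor k v (tapeState A s n h) (B := nbool A h)
    (tapeTuple (f := fun C => den k v C) h x q) p
  rw [← e, ← e]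
  exact this

/-- Since `G` sees only the `l`-th coordinate, every other coordinate can be summed out, leaving the
factor `∑ i, a m i`. -/
theorem sum_prod_smul_apply {M : Type*} [AddCommGroup M] [Module k M] (l : Fin h)
    (G : Fin s → M) :
    ∑ i : Fin h → Fin s, (∏ m, a m (i m)) • G (i l) =
      (∏ m ∈ Finset.univ.erase l, ∑ i, a m i) • ∑ i, a l i • G i := by
  -- A Kronecker delta in the `l`-th factor makes the vector independent of `i`, while the
  -- coefficient remains a product over coordinates.
  have h1 : ∀ i : Fin h → Fin s, (∏ m, a m (i m)) • G (i l) =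
      ∑ j, (∏ m, if m = l then (if i m = j then a m (i m) else 0) else a m (i m)) • G j := by
    intro i
    rw [Finset.sum_eq_single (i l)]
    · congr 1
      refine Finset.prod_congr rfl fun m _ => ?_
      split_ifs with h1 h2
      · rfl
      · exact absurd (congrArg i h1) h2
      · rfl
    · intro j _ hj
      rw [Finset.prod_eq_zero (Finset.mem_univ l), zero_smul]
      rw [if_pos rfl, if_neg (Ne.symm hj)]
    · simp
  simp only [h1]
  rw [Finset.sum_comm, Finset.smul_sum]
  refine Finset.sum_congr rfl fun j _ => ?_
  rw [← Finset.sum_smul, smul_smul]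
  congr 1
  -- Distributivity turns the sum over all tapes into a product of sums, whose `l`-th factor
  -- collapses to `a l j`.
  have h2 := Finset.prod_univ_sum (fun _ : Fin h => (Finset.univ : Finset (Fin s)))
    (fun m r => if m = l then (if r = j then a m r else 0) else a m r)
  rw [Fintype.piFinset_univ] at h2
  rw [← h2, ← Finset.prod_erase_mul _ _ (Finset.mem_univ l)]
  congr 1
  · refine Finset.prod_congr rfl fun m hm => ?_
    simp [Finset.ne_of_mem_erase hm]
  · simp

theorem stateVec_eq (A : Formula α) : stateVec k v A δ a b c =
    ∑ l : Fin h, c l • (∏ m ∈ Finset.univ.erase l, ∑ i : Fin s, a m i) •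
      ∑ i : Fin s, ∑ q : Fin n, (a l i * b q) • num k v A (δ (i, q)).2.1 := by
  have h1 : stateVec k v A δ a b c = ∑ l : Fin h, c l • ∑ i : Fin h → Fin s, (∏ m, a m (i m)) •
      ∑ q : Fin n, b q • num k v A (δ (i l, q)).2.1 := by
    simp only [stateVec, Finset.smul_sum, smul_smul]
    refine ((Finset.sum_congr rfl fun i _ => Finset.sum_comm).trans Finset.sum_comm).trans ?_
    refine Finset.sum_congr rfl fun l _ => Finset.sum_congr rfl fun i _ =>
      Finset.sum_congr rfl fun q _ => congrArg (· • _) ?_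
    ring
  rw [h1]
  refine Finset.sum_congr rfl fun l _ => ?_
  rw [sum_prod_smul_apply k a l fun i => ∑ q : Fin n, b q • num k v A (δ (i, q)).2.1]
  simp only [Finset.smul_sum, smul_smul]

theorem headVec_eq (A : Formula α) : headVec k v A δ a b c =
    ∑ l : Fin h, c l • (∏ m ∈ Finset.univ.erase l, ∑ i : Fin s, a m i) •
      ∑ i : Fin s, ∑ q : Fin n, ∑ p : Fin h,
        (a l i * b q * c p) • num k v A ((δ (i, q)).2.2.move p) := by
  have h1 : headVec k v A δ a b c = ∑ l : Fin h, c l • ∑ i : Fin h → Fin s, (∏ m, a m (i m)) •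
      ∑ q : Fin n, ∑ p : Fin h, (b q * c p) • num k v A ((δ (i l, q)).2.2.move p) := by
    simp only [headVec, Finset.smul_sum, smul_smul]
    -- The sum over `l` is moved outwards past those over `p`, `q` and `i` in turn.
    refine ((Finset.sum_congr rfl fun i _ => (Finset.sum_congr rfl fun q _ =>
      Finset.sum_comm).trans Finset.sum_comm).trans Finset.sum_comm).trans ?_
    refine Finset.sum_congr rfl fun l _ => Finset.sum_congr rfl fun i _ =>
      Finset.sum_congr rfl fun q _ => Finset.sum_congr rfl fun p _ => congrArg (· • _) ?_
    ring
  rw [h1]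
  refine Finset.sum_congr rfl fun l _ => ?_
  rw [sum_prod_smul_apply k a l fun i => ∑ q : Fin n, ∑ p : Fin h,
    (b q * c p) • num k v A ((δ (i, q)).2.2.move p)]
  simp only [Finset.smul_sum, smul_smul, mul_assoc]

end Step

end ILL

theorem mainTheorem6 {α : Type*} (A : Formula α) (s n h : ℕ) [NeZero s] [NeZero n] [NeZero h]
    (δ : Fin s × Fin n → Fin s × Fin n × Dir) :
    ∃ absstep : Deriv [absConfig A s n h] (absConfig A s n h),
      IsComponentwisePlainTensor absstep ∧
      (∀ C : Config s n h,
        CutEquiv (Deriv.cut (Δ := []) (C.proof A) absstep) ((C.step δ).proof A)) ∧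
      (∀ (k : Type*) [Field k] [IsAlgClosed k] (v : α → ModuleCat k)
        (a : Fin h → Fin s → k) (b : Fin n → k) (c : Fin h → k),
        denoteMap k v absstep
            (vacTensor k v (tapeState A s n h)
              (tapeTuple h (fun m => comb k v A (a m)) (comb k v A b)) (comb k v A c)) =
          vacTensor k v (tapeState A s n h)
            (tapeTuple h (fun m => symbolVec k v A δ a b c m) (stateVec k v A δ a b c))
            (headVec k v A δ a b c) ∧
        stateVec k v A δ a b c =
          ∑ l : Fin h, c l • (∏ m ∈ Finset.univ.erase l, ∑ i : Fin s, a m i) •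
            ∑ i : Fin s, ∑ q : Fin n, (a l i * b q) • num k v A (δ (i, q)).2.1 ∧
        headVec k v A δ a b c =
          ∑ l : Fin h, c l • (∏ m ∈ Finset.univ.erase l, ∑ i : Fin s, a m i) •
            ∑ i : Fin s, ∑ q : Fin n, ∑ p : Fin h,
              (a l i * b q * c p) • num k v A ((δ (i, q)).2.2.move p)) := by
  refine ⟨absstep A δ, absstep_isComponentwisePlain A δ, cut_absstep A δ, ?_⟩
  intro k _ _ v a b c
  exact ⟨denoteMap_absstep k v δ a b c A, stateVec_eq k v δ a b c A, headVec_eq k v δ a b c A⟩
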